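/- Let $d\in\mathbb N$, $\sigma>0$, and let $\mathcal P(\mathbb R^d)$ be the set of Borel probability measures on $\mathbb R^d$ with the topology of weak convergence. A function $G:\mathcal P(\mathbb R^d)\times\mathbb R^d\to\mathbb R$ is a *flat derivative* of $F:\mathcal P(\mathbb R^d)\to\mathbb R$ if $G(m,\cdot)$ is measurable and bounded for each $m$, $G(\cdot,x)$ is continuous for each $x$, and $$F(m')-F(m)=\int_0^1\int_{\mathbb R^d}G\big(m+\lambda(m'-m),x\big)\,(m'-m)(dx)\,d\lambda\qquad\text{for all } m,m'\in\mathcal P(\mathbb R^d).$$ **Assumption 1.** $F$ has a flat derivative $\frac{\delta F}{\delta m}$ with $\int\frac{\delta F}{\delta m}(m,x)\,m(dx)=0$ for all $m$, and for each $x$ the map $m\mapsto\frac{\delta F}{\delta m}(m,x)$ has a flat derivative $\frac{\delta^2F}{\delta m^2}(m,x,\cdot)$; moreover $F(m)-F(m')\le\int\frac{\delta F}{\delta m}(m,x)\,(m-m')(dx)$ for all $m,m'$, and there are constants $C,C_2>0$ with $|\frac{\delta F}{\delta m}(m,x)|\le C$ and $|\frac{\delta^2F}{\delta m^2}(m,x,y)|\le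 C_2$ for all $m,x,y$. Let $U:\mathbb R^d\to\mathbb R$ with $\int e^{-U(x)}dx<\infty$ and let $\pi$ be the probability measure with density proportional to $e^{-U}$. Densities with respect to Lebesgue measure are denoted by the same letter as the measure. **Assumption 2.** $m_0\in\mathcal P(\mathbb R^d)$ is absolutely continuous and there are $r>0$, $R>1$ with $r\le m_0(x)/\pi(x)\le R$ for almost every $x$. Put $V^\sigma(m)=F(m)+\frac{\sigma^2}{2}\operatorname{KL}(m|\pi)\in(-\infty,\infty]$, let $m^{\sigma,*}$ be a minimizer of $V^\sigma$ over $\mathcal P(\mathbb R^d)$, and let $(m_t)_{t\ge0}$ be a flow of absolutely continuous probability measures starting at $m_0$, with $\operatorname{KL}(m_t|\pi)<\infty$ for all $t\ge 0$, which solves the birth-death (Fisher-Rao gradient flow) equation $$\partial_t m_t(x)=-a(m_t,x)\,m_t(x),\qquad a(m,x)=\frac{\delta F}{\delta m}(m,x)+\frac{\sigma^2}{2}\log\frac{m(x)}{\pi(x)}-\frac{\sigma^2}{2}\operatorname{KL}(m|\pi),$$ for almost every $x$ and all $t\ge0$ (with a suitable choice of the densities $m_t(x)$). **Corollary.** Under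 Assumptions 1 and 2, there exist constants $\bar r>0$ and $\bar R>1$ such that $$\bar r\le\frac{m_0(x)}{m^{\sigma,*}(x)}\le\bar R\qquad\text{for almost every } x\in\mathbb R^d,$$ and for any such constants $\bar r,\bar R$, $$V^\sigma(m_t)-V^\sigma(m^{\sigma,*})\le\big(V^\sigma(m_0)-V^\sigma(m^{\sigma,*})\big)\,e^{-\kappa t}\quad\text{for all }t\ge0,\qquad\text{where }\kappa=\frac{\sigma^2\bar r}{4\bar R}.$$ -/

import Mathlib

open MeasureTheory Set Filter Topology

noncomputable section

namespace FisherRao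

/-- `ℝ^d` with its Euclidean norm and Lebesgue measure. -/
abbrev E (d : ℕ) : Type := EuclideanSpace ℝ (Fin d)

/-- The Borel probability measures on `ℝ^d`, with the topology of weak convergence. -/
abbrev P (d : ℕ) : Type := ProbabilityMeasure (E d)

/-- The mixture `m + l (m' - m) = (1 - l) m + l m'`, for `l ∈ [0, 1]`. -/
def mix {d : ℕ} (m m' : P d) (l : unitInterval) : P d :=
  ⟨ENNReal.ofReal (1 - (l : ℝ)) • (m : Measure (E d)) +
      ENNReal.ofReal (l : ℝ) • (m' : Measure (E d)), ⟨by
    have h1 : (0 : ℝ) ≤ 1 - (l : ℝ) := sub_nonneg.2 l.2.2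
    have h2 : (0 : ℝ) ≤ (l : ℝ) := l.2.1
    simp only [Measure.coe_add, Measure.coe_smul, Pi.add_apply, Pi.smul_apply, measure_univ,
      smul_eq_mul, mul_one]
    rw [← ENNReal.ofReal_add h1 h2]
    simp⟩⟩

/-- `G = δF/δm` is a flat (linear functional) derivative of `F : 𝒫(ℝ^d) → ℝ`.
In the last field `s` runs over `[0, 1]`, where `projIcc` is the identity. -/
structure IsFlatDeriv {d : ℕ} (F : P d → ℝ) (G : P d → E d → ℝ) : Prop where
  measurable : ∀ m, Measurable (G m)
  continuous : ∀ x, Continuous fun m => G m x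
  bounded : ∀ m, ∃ K : ℝ, 0 < K ∧ ∀ x, |G m x| ≤ K
  integral_eq : ∀ m m' : P d,
    F m' - F m =
      ∫ s in (0 : ℝ)..1,
        ((∫ x, G (mix m m' (projIcc 0 1 zero_le_one s)) x ∂(m' : Measure (E d))) -
          ∫ x, G (mix m m' (projIcc 0 1 zero_le_one s)) x ∂(m : Measure (E d)))

/-- The assumption on the functional `F`: it has flat derivatives `δF` of first order (normalised
to have mean zero) and `δ2F` of second order, it is convex, and both derivatives are bounded. -/
structure EnergyAssumption {d : ℕ} (F : P d → ℝ) (δF : P d → E d → ℝ)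
    (δ2F : P d → E d → E d → ℝ) : Prop where
  first : IsFlatDeriv F δF
  normalised : ∀ m : P d, ∫ x, δF m x ∂(m : Measure (E d)) = 0
  second : ∀ x, IsFlatDeriv (fun m => δF m x) (fun m y => δ2F m x y)
  convex : ∀ m m' : P d,
    F m - F m' ≤ (∫ x, δF m x ∂(m : Measure (E d))) - ∫ x, δF m x ∂(m' : Measure (E d))
  bound_first : ∃ C : ℝ, 0 < C ∧ ∀ m x, |δF m x| ≤ C
  bound_second : ∃ C₂ : ℝ, 0 < C₂ ∧ ∀ m x y, |δ2F m x y| ≤ C₂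

/-- `π(dx) = Z⁻¹ exp(-U(x)) dx` with the normalising constant `Z = ∫ exp(-U(x)) dx < ∞`. -/
def IsGibbs {d : ℕ} (U : E d → ℝ) (π : P d) : Prop :=
  Integrable (fun x => Real.exp (-U x)) (volume : Measure (E d)) ∧
    (π : Measure (E d)) =
      volume.withDensity fun x => ENNReal.ofReal (Real.exp (-U x) / ∫ y, Real.exp (-U y))

/-- The Lebesgue density `m(x)` of (the absolutely continuous part of) `m`. -/
def dens {d : ℕ} (m : P d) (x : E d) : ℝ :=
  ((m : Measure (E d)).rnDeriv volume x).toReal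

/-- `c₁ ≤ m(x) / m'(x) ≤ c₂` for Lebesgue-almost every `x`. -/
def RatioBounds {d : ℕ} (m m' : P d) (c₁ c₂ : ℝ) : Prop :=
  ∀ᵐ x ∂(volume : Measure (E d)), c₁ ≤ dens m x / dens m' x ∧ dens m x / dens m' x ≤ c₂

/-- The assumption on the initial measure: it is absolutely continuous and comparable with `π`. -/
def InitialAssumption {d : ℕ} (m₀ π : P d) : Prop :=
  (m₀ : Measure (E d)) ≪ volume ∧ ∃ r R : ℝ, 0 < r ∧ 1 < R ∧ RatioBounds m₀ π r R

/-- `KL(m | π) ∈ [0, ∞]`. -/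
def KL {d : ℕ} (m π : P d) : ENNReal :=
  InformationTheory.klDiv (m : Measure (E d)) (π : Measure (E d))

/-- The regularised energy `V^σ(m) = F(m) + (σ² / 2) KL(m | π) ∈ (-∞, ∞]`. -/
def energy {d : ℕ} (F : P d → ℝ) (σ : ℝ) (π m : P d) : EReal :=
  (F m : EReal) + ((σ ^ 2 / 2 : ℝ) : EReal) * ((KL m π : ENNReal) : EReal)

/-- `a(m, x) = δF/δm (m, x) + (σ² / 2) log (m(x) / π(x)) - (σ² / 2) KL(m | π)`, where the density
of `m` is represented by `q`. -/
def rate {d : ℕ} (δF : P d → E d → ℝ) (σ : ℝ) (π m : P d) (q : E d → ℝ) (x : E d) : ℝ :=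
  δF m x + σ ^ 2 / 2 * Real.log (q x / dens π x) - σ ^ 2 / 2 * (KL m π).toReal

/-- `(m_t)_{t ≥ 0}` solves the birth-death equation `∂_t m_t(x) = - a(m_t, x) m_t(x)`: the `m_t`
have finite relative entropy and densities `p t` such that, for almost every `x`, the function
`t ↦ p t x` is differentiable on `[0, ∞)` (one-sidedly at `0`) and satisfies the equation
at every `t ≥ 0`. -/
def IsBirthDeathFlow {d : ℕ} (δF : P d → E d → ℝ) (σ : ℝ) (π : P d) (m : ℝ → P d) : Prop :=
  ∃ p : ℝ → E d → ℝ,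
    (∀ t, 0 ≤ t → Measurable (p t) ∧ (∀ x, 0 ≤ p t x) ∧
      (m t : Measure (E d)) = volume.withDensity fun x => ENNReal.ofReal (p t x)) ∧
    (∀ t, 0 ≤ t → KL (m t) π ≠ ⊤) ∧
    ∀ᵐ x ∂(volume : Measure (E d)), ∀ t, 0 ≤ t →
      HasDerivWithinAt (fun s => p s x) (-(rate δF σ π (m t) (p t) x) * p t x) (Ici 0) t

end FisherRao

end

/-!
The proof does not use a Polyak–Łojasiewicz inequality along the flow, since this would need bounds
on `m_t / mstar` at all times. It combines two integrated estimates that only see the initial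
measure. Put `τ = σ² / 2`, `V = V^σ`, `a = a(m_t, ·)` and `D(t) = KL(mstar | m_t)`.

The logarithm of `m_t / π` solves a linear damped equation with bounded forcing up to a spatially
constant term, so it is bounded uniformly in `t` and `x` (`exists_isLogDensityFlow`); all integrals
can then be differentiated in time. The minimiser is a Gibbs measure relative to `π`, with bounded
log-density (`minimiser_eq_tilted`, `exists_logDensity_minimiser`), which gives the ratio bounds.

The dissipation identity is `V(m_t)' = -∫ a² dm_t`, and convexity of `F` gives
`D' = ∫ a dmstar ≤ -(V(m_t) - V(mstar)) - τ D`. Since `V(m_t)` is nonincreasing, integration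
against `exp (τ t)` leads to
`(exp (τ t) - 1) (V(m_t) - V(mstar)) ≤ τ (D(0) - D(t))` (`exp_sub_one_mul_excess_le`).
In the other direction, `log u ≤ 2 (√u - 1)` and the Cauchy–Schwarz inequality for
`√m_t - √m_0 = -∫ a √m_s / 2 ds` bound `D(0) - D(t)` by
`(λ / 2) (V(m_0) - V(m_t)) + t χ / (2 λ)` for every `λ > 0`, where `χ` is the `χ²`-divergence of
`mstar` from `m_0` (`integral_logDensity_sub_le`). Finally
`χ ≤ (2 Rbar / rbar) KL(m_0 | mstar) ≤ (2 Rbar / (rbar τ)) (V(m_0) - V(mstar))`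
(`chiSq_le_relEntropy`, `relEntropy_le_excess`). With `β = rbar / (2 Rbar) ≤ 1 / 2` and
`λ = exp (β τ t) / (β τ)` these inequalities imply the decay at rate `κ = β τ`
(`le_mul_exp_neg_of_integrated`).
-/

open InformationTheory

namespace FisherRao

/-! ### Real inequalities and scalar differential inequalities -/

/-- The function `klFun u = u log u + 1 - u` dominates the quadratic `(u - 1)² / (2 max(1, u))`. -/
lemma sq_sub_one_le_mul_klFun {u c : ℝ} (hu : 0 < u) (hc : 1 ≤ c) (huc : u ≤ c) :
    (u - 1) ^ 2 ≤ 2 * c * klFun u := by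
  have hk : 0 ≤ klFun u := klFun_nonneg hu.le
  rcases le_total 1 u with h | h
  · have h1 := Real.le_log_one_add_of_nonneg (sub_nonneg.2 h)
    have h2 : 2 * (u - 1) ≤ Real.log u * (u + 1) := by
      have : (1 : ℝ) + (u - 1) = u := by ring
      rw [this, div_le_iff₀ (by linarith)] at h1
      linarith
    have h3 : (u - 1) ^ 2 ≤ (u + 1) * klFun u := by
      rw [klFun_apply]
      nlinarith [mul_le_mul_of_nonneg_left h2 hu.le]
    nlinarith
  · have h1 : Real.log u⁻¹ ≤ Real.sinh (Real.log u⁻¹) :=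
      Real.self_le_sinh_iff.2 (Real.log_nonneg ((one_le_inv₀ hu).2 h))
    rw [Real.sinh_log (inv_pos.2 hu), inv_inv, Real.log_inv] at h1
    have h2 : u ^ 2 - 1 ≤ 2 * (u * Real.log u) := by
      have := mul_le_mul_of_nonneg_left h1 hu.le
      have h4 : u * ((u⁻¹ - u) / 2) = (1 - u ^ 2) / 2 := by field_simp
      rw [h4] at this
      linarith
    have h3 : (u - 1) ^ 2 ≤ 2 * klFun u := by
      rw [klFun_apply]
      nlinarith
    nlinarith

/-- A solution of `q' = -d - τ q` with `-d < τ N` cannot cross the level `N` upwards. -/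
lemma le_of_linear_ode {q d : ℝ → ℝ} {τ N : ℝ}
    (hq : ∀ t, 0 ≤ t → HasDerivWithinAt q (-d t - τ * q t) (Ici 0) t)
    (hd : ∀ t, 0 ≤ t → -d t < τ * N) (h0 : q 0 ≤ N) {t : ℝ} (ht : 0 ≤ t) : q t ≤ N := by
  refine image_le_of_deriv_right_lt_deriv_boundary (f := q) (a := 0) (b := t)
    (B := fun _ => N) (B' := fun _ => 0)
    (fun s hs => (hq s hs.1).continuousWithinAt.mono Icc_subset_Ici_self)
    (fun s hs => (hq s hs.1).mono (Ici_subset_Ici.2 hs.1)) h0 (fun s => hasDerivAt_const s N)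
    (fun s hs h => ?_) ⟨ht, le_rfl⟩
  rw [h]
  linarith [hd s hs.1]

/-- A solution of `y' = -(g + τ log y) y` with `g < τ N` cannot fall below `exp (-N)`. -/
lemma exp_neg_le_of_log_ode {y g : ℝ → ℝ} {τ N : ℝ}
    (hy : ∀ t, 0 ≤ t → HasDerivWithinAt y (-(g t + τ * Real.log (y t)) * y t) (Ici 0) t)
    (hg : ∀ t, 0 ≤ t → g t < τ * N) (h0 : Real.exp (-N) ≤ y 0) {t : ℝ} (ht : 0 ≤ t) :
    Real.exp (-N) ≤ y t := by
  have key : -y t ≤ -Real.exp (-N) := by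
    refine image_le_of_deriv_right_lt_deriv_boundary (f := fun s => -y s) (a := 0) (b := t)
      (B := fun _ => -Real.exp (-N)) (B' := fun _ => 0)
      (fun s hs => (hy s hs.1).continuousWithinAt.neg.mono Icc_subset_Ici_self)
      (fun s hs => (hy s hs.1).neg.mono (Ici_subset_Ici.2 hs.1)) (neg_le_neg h0)
      (fun s => hasDerivAt_const s _) (fun s hs h => ?_) ⟨ht, le_rfl⟩
    rw [neg_inj.1 h, Real.log_exp]
    have := hg s hs.1
    nlinarith [Real.exp_pos (-N)]
  linarith

/-- The passage from the integrated estimate to exponential decay, in which `z` is the rescaled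
time, `f₀` and `f` are the initial and the current excess energy. -/
lemma le_mul_exp_neg_of_integrated {f₀ f β z : ℝ} (hβ : 0 < β) (hβ' : 2 * β ≤ 1) (hz : 0 ≤ z)
    (hf₀ : 0 ≤ f₀)
    (h : f * (Real.exp z - 1) ≤
      Real.exp (β * z) / (2 * β) * (f₀ - f) + z * f₀ * Real.exp (-(β * z)) / 2) :
    f ≤ f₀ * Real.exp (-(β * z)) := by
  set v := β * z with hv
  have hv0 : 0 ≤ v := by positivity
  set E := Real.exp v with hE
  have hE1 : v + 1 ≤ E := Real.add_one_le_exp v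
  have hEpos : 0 < E := Real.exp_pos v
  have hE2 : E ^ 2 ≤ 2 * β * Real.exp z + (1 - 2 * β) := by
    have := convexOn_exp.2 (mem_univ z) (mem_univ 0) (by positivity : 0 ≤ 2 * β)
      (by linarith : 0 ≤ 1 - 2 * β) (by ring)
    simp only [smul_eq_mul, mul_zero, add_zero, Real.exp_zero, mul_one] at this
    calc E ^ 2 = Real.exp (2 * β * z) := by
          rw [hE, ← Real.exp_nat_mul]; congr 1; push_cast; ring
      _ ≤ _ := this
  rw [Real.exp_neg, ← hE] at h ⊢
  have h1 : f * E * (2 * β * (Real.exp z - 1) + E) ≤ f₀ * (E ^ 2 + v) := by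
    have := mul_le_mul_of_nonneg_left h (by positivity : 0 ≤ 2 * β * E)
    have e : 2 * β * E * (E / (2 * β) * (f₀ - f) + z * f₀ * E⁻¹ / 2)
        = E ^ 2 * (f₀ - f) + v * f₀ := by
      rw [hv]; field_simp
    rw [e] at this
    linarith
  have h2 : E ^ 2 + v ≤ 2 * β * (Real.exp z - 1) + E := by linarith
  have hpos : 0 < 2 * β * (Real.exp z - 1) + E := by nlinarith [sq_nonneg E]
  have h3 : f * E ≤ f₀ := by
    by_contra! hlt
    nlinarith [mul_le_mul_of_nonneg_left h2 hf₀]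
  rwa [← div_eq_mul_inv, le_div_iff₀ hEpos]

/-- Differentiation under the integral sign on the closed half-line `[0, ∞)`, with one-sided
derivative at `0`, for a derivative that is bounded by a constant. -/
lemma hasDerivWithinAt_integral_Ici {α : Type*} [MeasurableSpace α] {μ : Measure α}
    [IsFiniteMeasure μ] {g g' : ℝ → α → ℝ} {K : ℝ}
    (hg : ∀ t, 0 ≤ t → Integrable (g t) μ)
    (hd : ∀ᵐ x ∂μ, ∀ t, 0 ≤ t → HasDerivWithinAt (fun s => g s x) (g' t x) (Ici 0) t)
    (hK : ∀ᵐ x ∂μ, ∀ t, 0 ≤ t → |g' t x| ≤ K) {t : ℝ} (ht : 0 ≤ t) :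
    HasDerivWithinAt (fun s => ∫ x, g s x ∂μ) (∫ x, g' t x ∂μ) (Ici 0) t := by
  rw [hasDerivWithinAt_iff_tendsto_slope]
  have hmem : ∀ᶠ s in 𝓝[Ici 0 \ {t}] t, s ∈ Ici (0 : ℝ) \ {t} := self_mem_nhdsWithin
  have key : Tendsto (fun s => ∫ x, slope (fun r => g r x) t s ∂μ) (𝓝[Ici 0 \ {t}] t)
      (𝓝 (∫ x, g' t x ∂μ)) := by
    refine tendsto_integral_filter_of_dominated_convergence (fun _ => K) ?_ ?_
      (integrable_const K) ?_
    · filter_upwards [hmem] with s hs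
      simp only [slope_def_field]
      exact (((hg s hs.1).sub (hg t ht)).div_const _).aestronglyMeasurable
    · filter_upwards [hmem] with s hs
      filter_upwards [hd, hK] with x hx hxK
      have := Convex.norm_image_sub_le_of_norm_hasDerivWithin_le (fun r hr => hx r hr)
        (fun r hr => hxK r hr) (convex_Ici 0) (mem_Ici.2 ht) hs.1
      rw [slope_def_field, norm_div]
      exact div_le_of_le_mul₀ (norm_nonneg _) ((abs_nonneg _).trans (hxK t ht)) this
    · filter_upwards [hd] with x hx
      exact hasDerivWithinAt_iff_tendsto_slope.1 (hx t ht)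
  refine key.congr' ?_
  filter_upwards [hmem] with s hs
  simp only [slope_def_field]
  rw [integral_div, integral_sub (hg s hs.1) (hg t ht)]

variable {d : ℕ}

/-! ### Mixtures and relative entropy -/

lemma coe_mix (m m' : P d) (l : unitInterval) :
    (mix m m' l : Measure (E d)) = ENNReal.ofReal (1 - (l : ℝ)) • (m : Measure (E d)) +
      ENNReal.ofReal (l : ℝ) • (m' : Measure (E d)) := rfl

lemma integrable_of_abs_le {μ : Measure (E d)} [IsFiniteMeasure μ] {g : E d → ℝ}
    (hg : Measurable g) {C : ℝ} (hC : ∀ x, |g x| ≤ C) : Integrable g μ :=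
  Integrable.of_bound hg.aestronglyMeasurable C (ae_of_all _ hC)

lemma integral_mix (m m' : P d) (l : unitInterval) {g : E d → ℝ}
    (hg : Integrable g (m : Measure (E d))) (hg' : Integrable g (m' : Measure (E d))) :
    ∫ x, g x ∂(mix m m' l : Measure (E d)) =
      (1 - (l : ℝ)) * ∫ x, g x ∂(m : Measure (E d)) +
        (l : ℝ) * ∫ x, g x ∂(m' : Measure (E d)) := by
  rw [coe_mix, integral_add_measure (hg.smul_measure ENNReal.ofReal_ne_top)
    (hg'.smul_measure ENNReal.ofReal_ne_top), integral_smul_measure, integral_smul_measure,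
    ENNReal.toReal_ofReal (sub_nonneg.2 l.2.2), ENNReal.toReal_ofReal l.2.1, smul_eq_mul,
    smul_eq_mul]

lemma tendsto_mix (m m' : P d) : Tendsto (mix m m') (𝓝 0) (𝓝 m) := by
  rw [ProbabilityMeasure.tendsto_iff_forall_integral_tendsto]
  intro φ
  have h : ∀ l : unitInterval, ∫ x, φ x ∂(mix m m' l : Measure (E d)) =
      (1 - (l : ℝ)) * ∫ x, φ x ∂(m : Measure (E d)) +
        (l : ℝ) * ∫ x, φ x ∂(m' : Measure (E d)) :=
    fun l => integral_mix m m' l (φ.integrable _) (φ.integrable _)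
  simp_rw [h]
  have hc : Continuous fun l : unitInterval => (1 - (l : ℝ)) * ∫ x, φ x ∂(m : Measure (E d)) +
        (l : ℝ) * ∫ x, φ x ∂(m' : Measure (E d)) := by fun_prop
  simpa using hc.tendsto 0

/-- Convexity of the relative entropy in its first argument. -/
lemma klDiv_convex_comb_le {α : Type*} [MeasurableSpace α] {μ μ' ν : Measure α}
    [IsFiniteMeasure μ] [IsFiniteMeasure μ'] [IsFiniteMeasure ν] (hμ : μ ≪ ν) (hμ' : μ' ≪ ν)
    {a b : ℝ} (ha : 0 ≤ a) (hb : 0 ≤ b) (hab : a + b = 1) :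
    klDiv (ENNReal.ofReal a • μ + ENNReal.ofReal b • μ') ν ≤
      ENNReal.ofReal a * klDiv μ ν + ENNReal.ofReal b * klDiv μ' ν := by
  have i1 : IsFiniteMeasure (ENNReal.ofReal a • μ) := Measure.smul_finite _ ENNReal.ofReal_ne_top
  have i2 : IsFiniteMeasure (ENNReal.ofReal b • μ') := Measure.smul_finite _ ENNReal.ofReal_ne_top
  have hmix : ENNReal.ofReal a • μ + ENNReal.ofReal b • μ' ≪ ν :=
    Measure.AbsolutelyContinuous.add_left (hμ.smul_left _) (hμ'.smul_left _)
  rw [klDiv_eq_lintegral_klFun_of_ac hμ, klDiv_eq_lintegral_klFun_of_ac hμ',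
    klDiv_eq_lintegral_klFun_of_ac hmix, ← lintegral_const_mul _ (by fun_prop),
    ← lintegral_const_mul _ (by fun_prop), ← lintegral_add_left (by fun_prop)]
  refine lintegral_mono_ae ?_
  filter_upwards [Measure.rnDeriv_add' (ENNReal.ofReal a • μ) (ENNReal.ofReal b • μ') ν,
    Measure.rnDeriv_smul_left_of_ne_top μ ν (r := ENNReal.ofReal a) ENNReal.ofReal_ne_top,
    Measure.rnDeriv_smul_left_of_ne_top μ' ν (r := ENNReal.ofReal b) ENNReal.ofReal_ne_top,
    Measure.rnDeriv_lt_top μ ν, Measure.rnDeriv_lt_top μ' ν] with x h1x h2x h3x ht ht'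
  rw [h1x, Pi.add_apply, h2x, h3x, Pi.smul_apply, Pi.smul_apply, smul_eq_mul,
    smul_eq_mul, ENNReal.toReal_add (ENNReal.mul_ne_top ENNReal.ofReal_ne_top ht.ne)
    (ENNReal.mul_ne_top ENNReal.ofReal_ne_top ht'.ne), ENNReal.toReal_mul, ENNReal.toReal_mul,
    ENNReal.toReal_ofReal ha, ENNReal.toReal_ofReal hb, ← ENNReal.ofReal_mul ha,
    ← ENNReal.ofReal_mul hb, ← ENNReal.ofReal_add
    (mul_nonneg ha (klFun_nonneg ENNReal.toReal_nonneg))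
    (mul_nonneg hb (klFun_nonneg ENNReal.toReal_nonneg))]
  exact ENNReal.ofReal_le_ofReal (convexOn_klFun.2 (mem_Ici.2 ENNReal.toReal_nonneg)
    (mem_Ici.2 ENNReal.toReal_nonneg) ha hb hab)

lemma KL_mix_le {m m' π : P d} (hm : KL m π ≠ ⊤) (hm' : KL m' π ≠ ⊤) (l : unitInterval) :
    KL (mix m m' l) π ≤
      ENNReal.ofReal (1 - (l : ℝ)) * KL m π + ENNReal.ofReal (l : ℝ) * KL m' π :=
  klDiv_convex_comb_le (klDiv_ne_top_iff.1 hm).1 (klDiv_ne_top_iff.1 hm').1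
    (sub_nonneg.2 l.2.2) l.2.1 (sub_add_cancel _ _)

/-- Relative entropy with respect to an exponentially tilted reference measure. -/
lemma toReal_klDiv_tilted {m π : P d} (hm : KL m π ≠ ⊤) {f : E d → ℝ}
    (hf : Measurable f) {C : ℝ} (hC : ∀ x, |f x| ≤ C) :
    (klDiv (m : Measure (E d)) ((π : Measure (E d)).tilted f)).toReal =
      (KL m π).toReal - ∫ x, f x ∂(m : Measure (E d)) +
        Real.log (∫ x, Real.exp (f x) ∂(π : Measure (E d))) := by
  obtain ⟨hac, hint⟩ := klDiv_ne_top_iff.1 hm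
  have hexp : Integrable (fun x => Real.exp (f x)) (π : Measure (E d)) :=
    integrable_of_abs_le (by fun_prop) (C := Real.exp C) fun x => by
      rw [abs_of_pos (Real.exp_pos _)]
      exact Real.exp_le_exp.2 ((le_abs_self _).trans (hC x))
  have hfi : Integrable f (m : Measure (E d)) := integrable_of_abs_le hf hC
  have := isProbabilityMeasure_tilted hexp
  have hac' : (m : Measure (E d)) ≪ (π : Measure (E d)).tilted f :=
    hac.trans (absolutelyContinuous_tilted hexp)
  rw [toReal_klDiv_of_measure_eq hac' (by simp), integral_llr_tilted_right hac hfi hexp hint, KL,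
    toReal_klDiv_of_measure_eq hac (by simp)]

/-! ### The minimiser of the regularised energy -/

lemma energy_eq_coe (F : P d → ℝ) (σ : ℝ) {π m : P d} (h : KL m π ≠ ⊤) :
    energy F σ π m = ((F m + σ ^ 2 / 2 * (KL m π).toReal : ℝ) : EReal) := by
  rw [energy, EReal.coe_add, EReal.coe_mul, EReal.coe_ennreal_toReal h]

lemma KL_ne_top_of_energy_le {F : P d → ℝ} {σ : ℝ} (hσ : 0 < σ) {π mstar : P d}
    (h : ∀ m', energy F σ π mstar ≤ energy F σ π m') : KL mstar π ≠ ⊤ := by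
  intro htop
  have hππ : KL π π ≠ ⊤ := by simp [KL]
  have h1 := h π
  rw [energy_eq_coe F σ hππ, energy, htop, EReal.coe_ennreal_top,
    EReal.coe_mul_top_of_pos (by positivity), EReal.coe_add_top, top_le_iff] at h1
  exact EReal.coe_ne_top _ h1

/-- The minimiser also minimises the energy linearised at it: this is the first-order condition,
obtained by moving from `mstar` towards `m'` along a mixture. -/
lemma linearised_energy_le {F : P d → ℝ} {δF : P d → E d → ℝ} {δ2F : P d → E d → E d → ℝ}
    (hF : EnergyAssumption F δF δ2F) {σ : ℝ} (hσ : 0 < σ) {π mstar : P d}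
    (hmin : ∀ m', energy F σ π mstar ≤ energy F σ π m') {m' : P d} (hm' : KL m' π ≠ ⊤) :
    ∫ x, δF mstar x ∂(mstar : Measure (E d)) + σ ^ 2 / 2 * (KL mstar π).toReal ≤
      ∫ x, δF mstar x ∂(m' : Measure (E d)) + σ ^ 2 / 2 * (KL m' π).toReal := by
  have hs := KL_ne_top_of_energy_le hσ hmin
  obtain ⟨C, -, hC⟩ := hF.bound_first
  have hτ : 0 < σ ^ 2 / 2 := by positivity
  have hint : ∀ (m : P d) (m₁ : P d), Integrable (δF m) (m₁ : Measure (E d)) := fun m m₁ =>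
    integrable_of_abs_le (hF.first.measurable m) (hC m)
  -- the inequality at the mixture, divided by the mixing parameter
  have hineq : ∀ l : unitInterval, 0 < (l : ℝ) →
      ∫ x, δF (mix mstar m' l) x ∂(mstar : Measure (E d)) + σ ^ 2 / 2 * (KL mstar π).toReal ≤
      ∫ x, δF (mix mstar m' l) x ∂(m' : Measure (E d)) + σ ^ 2 / 2 * (KL m' π).toReal := by
    intro l hl
    have hle := KL_mix_le hs hm' l
    have hfin : ENNReal.ofReal (1 - (l : ℝ)) * KL mstar π + ENNReal.ofReal (l : ℝ) * KL m' π ≠ ⊤ :=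
      ENNReal.add_ne_top.2 ⟨ENNReal.mul_ne_top ENNReal.ofReal_ne_top hs,
        ENNReal.mul_ne_top ENNReal.ofReal_ne_top hm'⟩
    have hmix : KL (mix mstar m' l) π ≠ ⊤ := ne_top_of_le_ne_top hfin hle
    have hle' := ENNReal.toReal_mono hfin hle
    rw [ENNReal.toReal_add (ENNReal.mul_ne_top ENNReal.ofReal_ne_top hs)
      (ENNReal.mul_ne_top ENNReal.ofReal_ne_top hm'), ENNReal.toReal_mul, ENNReal.toReal_mul,
      ENNReal.toReal_ofReal (sub_nonneg.2 l.2.2), ENNReal.toReal_ofReal l.2.1] at hle'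
    have h1 := hmin (mix mstar m' l)
    rw [energy_eq_coe F σ hs, energy_eq_coe F σ hmix, EReal.coe_le_coe_iff] at h1
    have h2 := hF.convex (mix mstar m' l) mstar
    rw [integral_mix _ _ _ (hint _ _) (hint _ _)] at h2
    have h3 := mul_le_mul_of_nonneg_left hle' hτ.le
    refine le_of_mul_le_mul_left ?_ hl
    linarith
  -- let the mixing parameter tend to zero
  set u : ℕ → unitInterval := fun n => ⟨1 / ((n : ℝ) + 1), by positivity, by
    rw [div_le_one (by positivity)]; linarith [(Nat.cast_nonneg n : (0 : ℝ) ≤ n)]⟩ with hu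
  have hu0 : Tendsto u atTop (𝓝 0) := by
    rw [tendsto_subtype_rng]
    exact tendsto_one_div_add_atTop_nhds_zero_nat
  have hlim : ∀ m₁ : P d, Tendsto (fun n => ∫ x, δF (mix mstar m' (u n)) x ∂(m₁ : Measure (E d)))
      atTop (𝓝 (∫ x, δF mstar x ∂(m₁ : Measure (E d)))) := fun m₁ =>
    tendsto_integral_of_dominated_convergence (fun _ => C)
      (fun n => (hF.first.measurable _).aestronglyMeasurable) (integrable_const C)
      (fun n => ae_of_all _ (hC _))
      (ae_of_all _ fun x => ((hF.first.continuous x).tendsto _).comp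
        ((tendsto_mix mstar m').comp hu0))
  exact le_of_tendsto_of_tendsto ((hlim mstar).add_const _) ((hlim m').add_const _)
    (Eventually.of_forall fun n => hineq (u n) (by simp only [hu]; positivity))

section Minimiser

variable {F : P d → ℝ} {δF : P d → E d → ℝ} {δ2F : P d → E d → E d → ℝ} {σ : ℝ} {π mstar : P d}

/-- The minimiser is the Gibbs measure with potential `(2 / σ²) δF/δm (mstar, ·)` relative to `π`:
up to an additive constant, the linearised energy of `m` is `σ² / 2` times the relative entropy
of `m` with respect to this Gibbs measure. -/
lemma minimiser_eq_tilted (hF : EnergyAssumption F δF δ2F) (hσ : 0 < σ)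
    (hmin : ∀ m', energy F σ π mstar ≤ energy F σ π m') :
    (mstar : Measure (E d)) =
      (π : Measure (E d)).tilted fun x => -δF mstar x / (σ ^ 2 / 2) := by
  obtain ⟨C, -, hC⟩ := hF.bound_first
  have hτ : 0 < σ ^ 2 / 2 := by positivity
  set f : E d → ℝ := fun x => -δF mstar x / (σ ^ 2 / 2) with hf
  have hfm : Measurable f := (hF.first.measurable mstar).neg.div_const _
  have hfC : ∀ x, |f x| ≤ C / (σ ^ 2 / 2) := fun x => by
    rw [hf, abs_div, abs_neg, abs_of_pos hτ]
    exact div_le_div_of_nonneg_right (hC _ _) hτ.le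
  have hexp : Integrable (fun x => Real.exp (f x)) (π : Measure (E d)) :=
    integrable_of_abs_le (by fun_prop) (C := Real.exp (C / (σ ^ 2 / 2))) fun x => by
      rw [abs_of_pos (Real.exp_pos _)]
      exact Real.exp_le_exp.2 ((le_abs_self _).trans (hfC x))
  have hprob := isProbabilityMeasure_tilted hexp
  set q : P d := ⟨(π : Measure (E d)).tilted f, hprob⟩ with hq
  have hqm : (q : Measure (E d)) = (π : Measure (E d)).tilted f := rfl
  have hs := KL_ne_top_of_energy_le hσ hmin
  have hqπ : KL q π ≠ ⊤ := by
    have hi : Integrable f (q : Measure (E d)) := integrable_of_abs_le hfm hfC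
    refine klDiv_ne_top (tilted_absolutelyContinuous _ _) ?_
    have hae : llr (q : Measure (E d)) (π : Measure (E d)) =ᵐ[(q : Measure (E d))]
        fun x => f x - Real.log (∫ x, Real.exp (f x) ∂(π : Measure (E d))) :=
      (tilted_absolutelyContinuous _ _).ae_le (log_rnDeriv_tilted_left_self hexp)
    exact (integrable_congr hae).2 (hi.sub (integrable_const _))
  have hJ := linearised_energy_le hF hσ hmin hqπ
  have h1 := toReal_klDiv_tilted hs hfm hfC
  have h2 := toReal_klDiv_tilted hqπ hfm hfC
  rw [← hqm, klDiv_self, ENNReal.toReal_zero] at h2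
  have hfi : ∀ m : P d, ∫ x, f x ∂(m : Measure (E d)) =
      -(∫ x, δF mstar x ∂(m : Measure (E d))) / (σ ^ 2 / 2) := fun m => by
    rw [hf, integral_div, integral_neg]
  rw [hfi] at h1 h2
  -- the Gibbs measure has linearised energy at least that of `mstar`
  have hzero : (klDiv (mstar : Measure (E d)) ((π : Measure (E d)).tilted f)).toReal ≤ 0 := by
    rw [h1, ← sub_le_sub_iff_right (0 : ℝ), sub_zero]
    nth_rewrite 2 [h2]
    have e : ∀ a b : ℝ, σ ^ 2 / 2 * (b - -a / (σ ^ 2 / 2)) = a + σ ^ 2 / 2 * b := fun a b => by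
      field_simp; ring
    have := le_of_mul_le_mul_left ((e _ _).trans_le (hJ.trans_eq (e _ _).symm)) hτ
    linarith
  have hne : klDiv (mstar : Measure (E d)) ((π : Measure (E d)).tilted f) ≠ ⊤ := by
    obtain ⟨hac, hint⟩ := klDiv_ne_top_iff.1 hs
    exact klDiv_ne_top (hac.trans (absolutelyContinuous_tilted hexp))
      (integrable_llr_tilted_right hac (integrable_of_abs_le hfm hfC) hint hexp)
  rw [← klDiv_eq_zero_iff]
  rcases (ENNReal.toReal_eq_zero_iff _).1 (le_antisymm hzero ENNReal.toReal_nonneg) with h | h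
  · exact h
  · exact absurd h hne

end Minimiser

/-! ### Densities relative to the reference measure -/

lemma toReal_klDiv_withDensity_exp {α : Type*} [MeasurableSpace α] {μ ν : Measure α}
    [IsProbabilityMeasure μ] [IsProbabilityMeasure ν] {g : α → ℝ} (hg : Measurable g)
    (h : μ = ν.withDensity fun x => ENNReal.ofReal (Real.exp (g x))) :
    (klDiv μ ν).toReal = ∫ x, g x ∂μ := by
  have hac : μ ≪ ν := h ▸ withDensity_absolutelyContinuous _ _
  rw [toReal_klDiv_of_measure_eq hac (by simp)]
  refine integral_congr_ae ?_
  have := Measure.rnDeriv_withDensity ν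
    (f := fun x => ENNReal.ofReal (Real.exp (g x))) (by fun_prop)
  rw [← h] at this
  filter_upwards [hac.ae_le this] with x hx
  rw [llr, hx, ENNReal.toReal_ofReal (Real.exp_pos _).le, Real.log_exp]

lemma klDiv_withDensity_exp_ne_top {α : Type*} [MeasurableSpace α] {μ ν : Measure α}
    [IsProbabilityMeasure μ] [IsProbabilityMeasure ν] {g : α → ℝ} (hg : Measurable g) {N : ℝ}
    (hN : ∀ x, |g x| ≤ N)
    (h : μ = ν.withDensity fun x => ENNReal.ofReal (Real.exp (g x))) :
    klDiv μ ν ≠ ⊤ := by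
  have hac : μ ≪ ν := h ▸ withDensity_absolutelyContinuous _ _
  refine klDiv_ne_top hac ?_
  have := Measure.rnDeriv_withDensity ν
    (f := fun x => ENNReal.ofReal (Real.exp (g x))) (by fun_prop)
  rw [← h] at this
  have hae : llr μ ν =ᵐ[μ] g := by
    filter_upwards [hac.ae_le this] with x hx
    rw [llr, hx, ENNReal.toReal_ofReal (Real.exp_pos _).le, Real.log_exp]
  exact (integrable_congr hae).2 (Integrable.of_bound hg.aestronglyMeasurable N (ae_of_all _ hN))

lemma integral_withDensity_exp {α : Type*} [MeasurableSpace α] {μ ν : Measure α}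
    {g : α → ℝ} (hg : Measurable g)
    (h : μ = ν.withDensity fun x => ENNReal.ofReal (Real.exp (g x))) (f : α → ℝ) :
    ∫ x, f x ∂μ = ∫ x, Real.exp (g x) * f x ∂ν := by
  rw [h, integral_withDensity_eq_integral_toReal_smul (by fun_prop)
    (ae_of_all _ fun x => ENNReal.ofReal_lt_top)]
  refine integral_congr_ae (ae_of_all _ fun x => ?_)
  simp only [smul_eq_mul]
  rw [ENNReal.toReal_ofReal (Real.exp_pos _).le]

lemma measurable_dens (m : P d) : Measurable (dens m) :=
  (Measure.measurable_rnDeriv _ _).ennreal_toReal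

lemma ae_dens_eq {m : P d} {f : E d → ℝ} (hf : AEMeasurable f (volume : Measure (E d)))
    (hf0 : ∀ x, 0 ≤ f x)
    (h : (m : Measure (E d)) = volume.withDensity fun x => ENNReal.ofReal (f x)) :
    ∀ᵐ x ∂(volume : Measure (E d)), dens m x = f x := by
  have := Measure.rnDeriv_withDensity₀ (volume : Measure (E d)) hf.ennreal_ofReal
  filter_upwards [this] with x hx
  rw [dens, h, hx, ENNReal.toReal_ofReal (hf0 x)]

section Gibbs

variable {U : E d → ℝ} {π : P d}

lemma IsGibbs.ae_dens_pos (hπ : IsGibbs U π) :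
    ∀ᵐ x ∂(volume : Measure (E d)), 0 < dens π x := by
  have hZ : 0 < ∫ y, Real.exp (-U y) := integral_exp_pos hπ.1
  filter_upwards [ae_dens_eq (hπ.1.aestronglyMeasurable.aemeasurable.div_const _)
    (fun x => by positivity) hπ.2] with x hx
  rw [hx]
  positivity

lemma IsGibbs.eq_withDensity_dens (hπ : IsGibbs U π) :
    (π : Measure (E d)) = volume.withDensity fun x => ENNReal.ofReal (dens π x) := by
  nth_rewrite 1 [hπ.2]
  refine withDensity_congr_ae ?_
  filter_upwards [ae_dens_eq (hπ.1.aestronglyMeasurable.aemeasurable.div_const _)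
    (fun x => by positivity) hπ.2] with x hx
  rw [hx]

lemma IsGibbs.ac_volume (hπ : IsGibbs U π) : (π : Measure (E d)) ≪ volume :=
  hπ.2 ▸ withDensity_absolutelyContinuous _ _

lemma IsGibbs.withDensity_eq (hπ : IsGibbs U π) {f : E d → ℝ} (hf : Measurable f)  :
    (π : Measure (E d)).withDensity (fun x => ENNReal.ofReal (f x)) =
      volume.withDensity fun x => ENNReal.ofReal (dens π x * f x) := by
  nth_rewrite 1 [hπ.eq_withDensity_dens]
  rw [← withDensity_mul _ (measurable_dens π).ennreal_ofReal hf.ennreal_ofReal]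
  refine withDensity_congr_ae (ae_of_all _ fun x => ?_)
  exact (ENNReal.ofReal_mul ENNReal.toReal_nonneg).symm

lemma IsGibbs.ae_dens_eq_mul_exp (hπ : IsGibbs U π) {m : P d} {g : E d → ℝ} (hg : Measurable g)
    (h : (m : Measure (E d)) =
      (π : Measure (E d)).withDensity fun x => ENNReal.ofReal (Real.exp (g x))) :
    ∀ᵐ x ∂(volume : Measure (E d)), dens m x = dens π x * Real.exp (g x) :=
  ae_dens_eq ((measurable_dens π).mul hg.exp).aemeasurable
    (fun _ => mul_nonneg ENNReal.toReal_nonneg (Real.exp_pos _).le)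
    (h.trans (hπ.withDensity_eq hg.exp))

end Gibbs

/-! ### Uniform bounds on the flow -/

/-- The rate `a(m, x)` in terms of the log-density `g` of `m` with respect to `π`, for which
the relative entropy of `m` is `∫ g dm`. -/
noncomputable def logRate (δF : P d → E d → ℝ) (τ : ℝ) (m : P d) (g : E d → ℝ) (x : E d) : ℝ :=
  δF m x + τ * g x - τ * ∫ y, g y ∂(m : Measure (E d))

/-- The flow `m` described by its log-densities `ℓ t = log (dm_t / dπ)`. They are bounded by `N`
uniformly in time and space, and solve `∂_t ℓ = -a` for `π`-almost every point. The bound holds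
everywhere and not only almost everywhere, which can be achieved by truncation. -/
structure IsLogDensityFlow (δF : P d → E d → ℝ) (τ : ℝ) (π : P d) (m : ℝ → P d)
    (ℓ : ℝ → E d → ℝ) (N : ℝ) : Prop where
  measurable : ∀ t, 0 ≤ t → Measurable (ℓ t)
  bound : ∀ t x, |ℓ t x| ≤ N
  density : ∀ t, 0 ≤ t → (m t : Measure (E d)) =
    (π : Measure (E d)).withDensity fun x => ENNReal.ofReal (Real.exp (ℓ t x))
  ode : ∀ᵐ x ∂(π : Measure (E d)), ∀ t, 0 ≤ t →
    HasDerivWithinAt (fun s => ℓ s x) (-logRate δF τ (m t) (ℓ t) x) (Ici 0) t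

/-- The log-density of a measure with respect to `π` is bounded uniformly along the flow. For the
birth-death equation, the logarithmic term damps the differences `ℓ t x - ℓ t y`, from which the
spatially constant entropy cancels; the normalisation of `m t` then bounds `ℓ t` itself. -/
lemma exists_isLogDensityFlow {δF : P d → E d → ℝ} {σ : ℝ} (hσ : 0 < σ) {C : ℝ}
    (hC : ∀ m x, |δF m x| ≤ C) {U : E d → ℝ} {π : P d} (hπ : IsGibbs U π) {m : ℝ → P d}
    (hm₀ : InitialAssumption (m 0) π) (hm : IsBirthDeathFlow δF σ π m) :
    ∃ (ℓ : ℝ → E d → ℝ) (N : ℝ), IsLogDensityFlow δF (σ ^ 2 / 2) π m ℓ N := by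
  obtain ⟨p, hp, -, hode⟩ := hm
  obtain ⟨-, r, R, hr, hR, hrR⟩ := hm₀
  set τ : ℝ := σ ^ 2 / 2 with hτdef
  have hτ : 0 < τ := by positivity
  have hC0 : 0 ≤ C := (abs_nonneg _).trans (hC (m 0) 0)
  -- large enough for the barrier arguments below: it dominates the initial log-oscillation and the
  -- equilibrium value `2 C / τ` of the damped equation
  set N : ℝ := |Real.log r| + |Real.log R| + (2 * C + 1) / τ with hN
  have hN1 : 2 * C < τ * N := by
    have : τ * N = τ * (|Real.log r| + |Real.log R|) + (2 * C + 1) := by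
      rw [hN]; field_simp
    rw [this]
    nlinarith [abs_nonneg (Real.log r), abs_nonneg (Real.log R)]
  have hN2 : |Real.log r| + |Real.log R| ≤ N := by
    rw [hN]; linarith [(by positivity : 0 ≤ (2 * C + 1) / τ)]
  set w : ℝ → E d → ℝ := fun t x => p t x / dens π x with hw
  have hwm : ∀ t, 0 ≤ t → Measurable (w t) := fun t ht => (hp t ht).1.div (measurable_dens π)
  have hwdens : ∀ t, 0 ≤ t → (m t : Measure (E d)) =
      (π : Measure (E d)).withDensity fun x => ENNReal.ofReal (w t x) := by
    intro t ht
    rw [hπ.withDensity_eq (hwm t ht), (hp t ht).2.2]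
    refine withDensity_congr_ae ?_
    filter_upwards [hπ.ae_dens_pos] with x hx
    simp only [hw]
    rw [mul_div_cancel₀ _ hx.ne']
  -- at a good point the density is positive and the equation for its logarithm holds
  set Good : E d → Prop := fun x => (∀ t, 0 ≤ t → 0 < w t x) ∧
    (r ≤ w 0 x ∧ w 0 x ≤ R) ∧
    ∀ t, 0 ≤ t → HasDerivWithinAt (fun s => Real.log (w s x))
      (-(δF (m t) x + τ * Real.log (w t x) - τ * (KL (m t) π).toReal)) (Ici 0) t with hGood
  have hgood : ∀ᵐ x ∂(π : Measure (E d)), Good x := by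
    have hp0 := ae_dens_eq (hp 0 le_rfl).1.aemeasurable (hp 0 le_rfl).2.1 (hp 0 le_rfl).2.2
    refine hπ.ac_volume.ae_le ?_
    filter_upwards [hode, hrR, hπ.ae_dens_pos, hp0] with x hx hrx hρ hp0x
    have hwode : ∀ t, 0 ≤ t → HasDerivWithinAt (fun s => w s x)
        (-((δF (m t) x - τ * (KL (m t) π).toReal) + τ * Real.log (w t x)) * w t x) (Ici 0) t := by
      intro t ht
      refine ((hx t ht).div_const (dens π x)).congr_deriv ?_
      simp only [rate, hw, hτdef]
      ring
    rw [hp0x] at hrx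
    have hpos : ∀ t, 0 ≤ t → 0 < w t x := fun t ht =>
      (Real.exp_pos (-N)).trans_le (exp_neg_le_of_log_ode hwode (fun s hs => by
        have h1 := (le_abs_self _).trans (hC (m s) x)
        have h2 : 0 ≤ τ * (KL (m s) π).toReal := mul_nonneg hτ.le ENNReal.toReal_nonneg
        linarith) (by
        refine le_trans ?_ hrx.1
        rw [← Real.exp_log hr]
        refine Real.exp_le_exp.2 ?_
        linarith [neg_abs_le (Real.log r), abs_nonneg (Real.log R)]) ht)
    refine ⟨hpos, hrx, fun t ht => ?_⟩
    refine ((hwode t ht).log (hpos t ht).ne').congr_deriv ?_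
    rw [mul_div_cancel_right₀ _ (hpos t ht).ne']
    ring
  -- the entropy term cancels in the difference of the equations at two points
  have hosc : ∀ x y, Good x → Good y → ∀ t, 0 ≤ t →
      Real.log (w t x) ≤ Real.log (w t y) + N := by
    rintro x y ⟨-, hx0, hx⟩ ⟨-, hy0, hy⟩ t ht
    have := le_of_linear_ode (q := fun s => Real.log (w s x) - Real.log (w s y))
      (d := fun s => δF (m s) x - δF (m s) y) (τ := τ) (N := N)
      (fun s hs => ((hx s hs).sub (hy s hs)).congr_deriv (by ring))
      (fun s hs => by
        have h1 := abs_le.1 (hC (m s) x)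
        have h2 := abs_le.1 (hC (m s) y)
        linarith) (by
        have h1 : Real.log (w 0 x) ≤ Real.log R := Real.log_le_log (hr.trans_le hx0.1) hx0.2
        have h2 : Real.log r ≤ Real.log (w 0 y) := Real.log_le_log hr hy0.1
        linarith [neg_abs_le (Real.log r), le_abs_self (Real.log R)]) ht
    linarith
  have hlog : ∀ x, Good x → ∀ t, 0 ≤ t → |Real.log (w t x)| ≤ N := by
    intro x hx t ht
    have hnull : (π : Measure (E d)) {y | ¬ Good y} = 0 := ae_iff.1 hgood
    have hw0 : ∀ y, 0 ≤ w t y := fun y => div_nonneg ((hp t ht).2.1 y) ENNReal.toReal_nonneg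
    have hlin : ∫⁻ y, ENNReal.ofReal (w t y) ∂(π : Measure (E d)) = 1 := by
      rw [← setLIntegral_univ, ← withDensity_apply _ MeasurableSet.univ, ← hwdens t ht,
        measure_univ]
    have hint : Integrable (w t) (π : Measure (E d)) :=
      (lintegral_ofReal_ne_top_iff_integrable (hwm t ht).aestronglyMeasurable
        (ae_of_all _ hw0)).1 (by rw [hlin]; exact ENNReal.one_ne_top)
    have hint1 : ∫ y, w t y ∂(π : Measure (E d)) = 1 := by
      rw [integral_eq_lintegral_of_nonneg_ae (ae_of_all _ hw0) (hwm t ht).aestronglyMeasurable,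
        hlin, ENNReal.toReal_one]
    -- the density has mean one, so it takes values at most one and at least one at good points
    obtain ⟨y, hy, hy1⟩ := exists_notMem_null_le_integral hint hnull
    obtain ⟨z, hz, hz1⟩ := exists_notMem_null_integral_le hint hnull
    simp only [mem_ofPred_eq, not_not] at hy hz
    rw [hint1] at hy1 hz1
    have hly : Real.log (w t y) ≤ 0 := Real.log_nonpos (hw0 y) hy1
    have hlz : 0 ≤ Real.log (w t z) := Real.log_nonneg hz1
    rw [abs_le]
    exact ⟨by linarith [hosc z x hz hx t ht], by linarith [hosc x y hx hy t ht]⟩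
  have hN0 : 0 ≤ N := le_trans (by positivity) hN2
  set ℓ : ℝ → E d → ℝ := fun t x => max (-N) (min N (Real.log (w t x))) with hℓ
  have hℓm : ∀ t, 0 ≤ t → Measurable (ℓ t) := fun t ht =>
    measurable_const.max (measurable_const.min (hwm t ht).log)
  have hℓeq : ∀ x, Good x → ∀ t, 0 ≤ t → ℓ t x = Real.log (w t x) := by
    intro x hx t ht
    have := abs_le.1 (hlog x hx t ht)
    simp only [hℓ]
    rw [min_eq_right this.2, max_eq_right this.1]
  have hdens : ∀ t, 0 ≤ t → (m t : Measure (E d)) =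
      (π : Measure (E d)).withDensity fun x => ENNReal.ofReal (Real.exp (ℓ t x)) := by
    intro t ht
    rw [hwdens t ht]
    refine withDensity_congr_ae ?_
    filter_upwards [hgood] with x hx
    rw [hℓeq x hx t ht, Real.exp_log (hx.1 t ht)]
  refine ⟨ℓ, N, hℓm, fun t x => ?_, hdens, ?_⟩
  · exact abs_le.2 ⟨le_max_left _ _, max_le (by linarith) (min_le_left _ _)⟩
  · filter_upwards [hgood] with x hx t ht
    have := hx.2.2 t ht
    rw [← hℓeq x hx t ht, KL, toReal_klDiv_withDensity_exp (hℓm t ht) (hdens t ht)] at this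
    exact this.congr (fun s hs => hℓeq x hx s hs) (hℓeq x hx t ht)

/-! ### Bounded measurable functions -/

/-- `g` is measurable and bounded. -/
def IsBddMeas {α : Type*} [MeasurableSpace α] (g : α → ℝ) : Prop :=
  Measurable g ∧ ∃ C : ℝ, ∀ x, |g x| ≤ C

namespace IsBddMeas

variable {α : Type*} [MeasurableSpace α] {f g : α → ℝ}

lemma integrable (hg : IsBddMeas g) (μ : Measure α) [IsFiniteMeasure μ] : Integrable g μ := by
  obtain ⟨hm, C, hC⟩ := hg
  exact Integrable.of_bound hm.aestronglyMeasurable C (ae_of_all _ hC)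

lemma const (c : ℝ) : IsBddMeas fun _ : α => c := ⟨measurable_const, |c|, fun _ => le_rfl⟩

lemma add (hf : IsBddMeas f) (hg : IsBddMeas g) : IsBddMeas fun x => f x + g x := by
  obtain ⟨hm, C, hC⟩ := hf
  obtain ⟨hm', C', hC'⟩ := hg
  exact ⟨hm.add hm', C + C', fun x => (abs_add_le _ _).trans (add_le_add (hC x) (hC' x))⟩

lemma neg (hf : IsBddMeas f) : IsBddMeas fun x => -f x := by
  obtain ⟨hm, C, hC⟩ := hf
  exact ⟨hm.neg, C, fun x => (abs_neg _).trans_le (hC x)⟩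

lemma sub (hf : IsBddMeas f) (hg : IsBddMeas g) : IsBddMeas fun x => f x - g x := by
  simpa only [sub_eq_add_neg] using hf.add hg.neg

lemma mul (hf : IsBddMeas f) (hg : IsBddMeas g) : IsBddMeas fun x => f x * g x := by
  obtain ⟨hm, C, hC⟩ := hf
  obtain ⟨hm', C', hC'⟩ := hg
  refine ⟨hm.mul hm', C * C', fun x => ?_⟩
  rw [abs_mul]
  exact mul_le_mul (hC x) (hC' x) (abs_nonneg _) ((abs_nonneg _).trans (hC x))

lemma pow (hf : IsBddMeas f) (n : ℕ) : IsBddMeas fun x => f x ^ n := by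
  obtain ⟨hm, C, hC⟩ := hf
  refine ⟨hm.pow_const n, C ^ n, fun x => ?_⟩
  rw [abs_pow]
  exact pow_le_pow_left₀ (abs_nonneg _) (hC x) n

lemma comp_continuous (hf : IsBddMeas f) {φ : ℝ → ℝ} (hφ : Continuous φ) :
    IsBddMeas fun x => φ (f x) := by
  obtain ⟨hm, C, hC⟩ := hf
  obtain ⟨B, hB⟩ := (isCompact_Icc (a := -C) (b := C)).exists_bound_of_continuousOn hφ.continuousOn
  exact ⟨hφ.measurable.comp hm, B, fun x => hB _ (abs_le.1 (hC x))⟩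

lemma exp (hf : IsBddMeas f) : IsBddMeas fun x => Real.exp (f x) :=
  hf.comp_continuous Real.continuous_exp

end IsBddMeas

lemma EnergyAssumption.isBddMeas {F : P d → ℝ} {δF : P d → E d → ℝ} {δ2F : P d → E d → E d → ℝ}
    (hF : EnergyAssumption F δF δ2F) (m : P d) : IsBddMeas (δF m) := by
  obtain ⟨C, -, hC⟩ := hF.bound_first
  exact ⟨hF.first.measurable m, C, hC m⟩

/-! ### Differentiation along the flow -/

namespace IsLogDensityFlow

variable {F : P d → ℝ} {δF : P d → E d → ℝ} {δ2F : P d → E d → E d → ℝ} {τ : ℝ} {π : P d}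
  {m : ℝ → P d} {ℓ : ℝ → E d → ℝ} {N : ℝ}

lemma isBddMeas (h : IsLogDensityFlow δF τ π m ℓ N) {t : ℝ} (ht : 0 ≤ t) : IsBddMeas (ℓ t) :=
  ⟨h.measurable t ht, N, h.bound t⟩

lemma integral_eq (h : IsLogDensityFlow δF τ π m ℓ N) {t : ℝ} (ht : 0 ≤ t) (f : E d → ℝ) :
    ∫ x, f x ∂(m t : Measure (E d)) = ∫ x, Real.exp (ℓ t x) * f x ∂(π : Measure (E d)) :=
  integral_withDensity_exp (h.measurable t ht) (h.density t ht) f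

lemma integral_exp (h : IsLogDensityFlow δF τ π m ℓ N) {t : ℝ} (ht : 0 ≤ t) :
    ∫ x, Real.exp (ℓ t x) ∂(π : Measure (E d)) = 1 := by
  simpa using (h.integral_eq ht fun _ => 1).symm

lemma isBddMeas_logRate (hF : EnergyAssumption F δF δ2F) (h : IsLogDensityFlow δF τ π m ℓ N)
    {t : ℝ} (ht : 0 ≤ t) : IsBddMeas (logRate δF τ (m t) (ℓ t)) :=
  ((hF.isBddMeas _).add ((IsBddMeas.const τ).mul (h.isBddMeas ht))).sub (IsBddMeas.const _)

lemma exists_abs_logRate_le (hF : EnergyAssumption F δF δ2F)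
    (h : IsLogDensityFlow δF τ π m ℓ N) :
    ∃ A : ℝ, ∀ t x, |logRate δF τ (m t) (ℓ t) x| ≤ A := by
  obtain ⟨C, -, hC⟩ := hF.bound_first
  refine ⟨C + |τ| * N + |τ| * N, fun t x => ?_⟩
  have h1 : |∫ y, ℓ t y ∂(m t : Measure (E d))| ≤ N := by
    simpa using norm_integral_le_of_norm_le_const (μ := (m t : Measure (E d)))
      (f := ℓ t) (C := N) (ae_of_all _ (h.bound t))
  refine (abs_sub _ _).trans (add_le_add ((abs_add_le _ _).trans (add_le_add (hC _ _) ?_)) ?_)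
  · rw [abs_mul]
    exact mul_le_mul_of_nonneg_left (h.bound t x) (abs_nonneg _)
  · rw [abs_mul]
    exact mul_le_mul_of_nonneg_left h1 (abs_nonneg _)

/-- The birth-death rate has mean zero, so the flow conserves mass. -/
lemma integral_exp_mul_logRate (hF : EnergyAssumption F δF δ2F)
    (h : IsLogDensityFlow δF τ π m ℓ N) {t : ℝ} (ht : 0 ≤ t) :
    ∫ x, Real.exp (ℓ t x) * logRate δF τ (m t) (ℓ t) x ∂(π : Measure (E d)) = 0 := by
  rw [← h.integral_eq ht]
  unfold logRate
  rw [integral_sub (((hF.isBddMeas _).add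
      ((IsBddMeas.const τ).mul (h.isBddMeas ht))).integrable _) (integrable_const _),
    integral_add ((hF.isBddMeas _).integrable _)
      (((IsBddMeas.const τ).mul (h.isBddMeas ht)).integrable _),
    hF.normalised, integral_const_mul]
  simp

/-- Differentiation along the flow of integrals of functions of the log-density. -/
lemma hasDerivWithinAt_integral_comp (hF : EnergyAssumption F δF δ2F)
    (h : IsLogDensityFlow δF τ π m ℓ N) {c : E d → ℝ} (hc : IsBddMeas c) {φ φ' : ℝ → ℝ}
    (hφ : ∀ y, HasDerivAt φ (φ' y) y) (hφ' : Continuous φ') {t : ℝ} (ht : 0 ≤ t) :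
    HasDerivWithinAt (fun s => ∫ x, c x * φ (ℓ s x) ∂(π : Measure (E d)))
      (∫ x, c x * (φ' (ℓ t x) * -logRate δF τ (m t) (ℓ t) x) ∂(π : Measure (E d))) (Ici 0) t := by
  have hφc : Continuous φ := continuous_iff_continuousAt.2 fun y => (hφ y).continuousAt
  obtain ⟨A, hA⟩ := h.exists_abs_logRate_le hF
  obtain ⟨B, hB⟩ :=
    (isCompact_Icc (a := -N) (b := N)).exists_bound_of_continuousOn hφ'.continuousOn
  obtain ⟨hcm, C, hC⟩ := id hc
  refine hasDerivWithinAt_integral_Ici (g := fun s x => c x * φ (ℓ s x))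
    (g' := fun s x => c x * (φ' (ℓ s x) * -logRate δF τ (m s) (ℓ s) x)) (K := C * (B * A))
    (fun s hs => (hc.mul ((h.isBddMeas hs).comp_continuous hφc)).integrable _) ?_
    (ae_of_all _ fun x s _ => ?_) ht
  · filter_upwards [h.ode] with x hx s hs
    exact ((hφ (ℓ s x)).comp_hasDerivWithinAt s (hx s hs)).const_mul (c x)
  · have h1 := hB (ℓ s x) (abs_le.1 (h.bound s x))
    rw [Real.norm_eq_abs] at h1
    have hB0 := (abs_nonneg _).trans h1
    rw [abs_mul, abs_mul, abs_neg]
    exact mul_le_mul (hC x) (mul_le_mul h1 (hA s x) (abs_nonneg _) hB0) (by positivity)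
      ((abs_nonneg _).trans (hC x))

lemma tendsto_flow (hF : EnergyAssumption F δF δ2F) (h : IsLogDensityFlow δF τ π m ℓ N)
    {t : ℝ} (ht : 0 ≤ t) : Tendsto m (𝓝[Ici 0] t) (𝓝 (m t)) := by
  rw [ProbabilityMeasure.tendsto_iff_forall_integral_tendsto]
  intro φ
  have hφ : IsBddMeas φ := ⟨φ.continuous.measurable, ‖φ‖, φ.norm_coe_le_norm⟩
  have := (h.hasDerivWithinAt_integral_comp hF hφ Real.hasDerivAt_exp Real.continuous_exp
    ht).continuousWithinAt
  rw [h.integral_eq ht]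
  simp_rw [mul_comm (Real.exp _)]
  refine Tendsto.congr' ?_ this
  filter_upwards [self_mem_nhdsWithin] with s hs
  rw [h.integral_eq hs]
  simp_rw [mul_comm (Real.exp _)]

/-- The chain rule for `F` along the flow. The convexity inequality, applied in both directions,
encloses the increment of `F` between two expressions with the same first-order behaviour. -/
lemma hasDerivWithinAt_energy (hF : EnergyAssumption F δF δ2F)
    (h : IsLogDensityFlow δF τ π m ℓ N) {t : ℝ} (ht : 0 ≤ t) :
    HasDerivWithinAt (fun s => F (m s))
      (∫ x, δF (m t) x * (Real.exp (ℓ t x) * -logRate δF τ (m t) (ℓ t) x) ∂(π : Measure (E d)))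
      (Ici 0) t := by
  obtain ⟨C, -, hC⟩ := hF.bound_first
  obtain ⟨A, hA⟩ := h.exists_abs_logRate_le hF
  have hlin := h.hasDerivWithinAt_integral_comp hF (hF.isBddMeas (m t)) Real.hasDerivAt_exp
    Real.continuous_exp ht
  set L : ℝ → ℝ := fun s => ∫ x, δF (m t) x * Real.exp (ℓ s x) ∂(π : Measure (E d)) with hL
  -- the densities are Lipschitz in time
  have hLip : ∀ s, 0 ≤ s → ∀ᵐ x ∂(π : Measure (E d)),
      |Real.exp (ℓ s x) - Real.exp (ℓ t x)| ≤ Real.exp N * A * |s - t| := by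
    intro s hs
    filter_upwards [h.ode] with x hx
    refine Convex.norm_image_sub_le_of_norm_hasDerivWithin_le
      (fun r hr => (hx r hr).exp) (fun r hr => ?_) (convex_Ici 0) (mem_Ici.2 ht) hs
    rw [norm_mul, norm_neg, Real.norm_eq_abs, Real.norm_eq_abs, abs_of_pos (Real.exp_pos _)]
    exact mul_le_mul (Real.exp_le_exp.2 ((le_abs_self _).trans (h.bound r x))) (hA r x)
      (abs_nonneg _) (Real.exp_pos _).le
  set e : ℝ → ℝ := fun s => ∫ x, |δF (m s) x - δF (m t) x| ∂(π : Measure (E d)) with he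
  have he0 : Tendsto e (𝓝[Ici 0] t) (𝓝 0) := by
    have : Tendsto e (𝓝[Ici 0] t) (𝓝 (∫ _, (0 : ℝ) ∂(π : Measure (E d)))) := by
      refine tendsto_integral_filter_of_dominated_convergence (fun _ => C + C)
        (Eventually.of_forall fun s =>
          ((hF.first.measurable _).sub (hF.first.measurable _)).abs.aestronglyMeasurable)
        (Eventually.of_forall fun s => ae_of_all _ fun x => ?_) (integrable_const _)
        (ae_of_all _ fun x => ?_)
      · rw [Real.norm_eq_abs, abs_abs]
        exact (abs_sub _ _).trans (add_le_add (hC _ _) (hC _ _))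
      · have h1 := ((hF.first.continuous x).tendsto (m t)).comp (h.tendsto_flow hF ht)
        simpa using (h1.sub_const (δF (m t) x)).abs
    simpa using this
  have hmain : ∀ s, 0 ≤ s →
      |(F (m s) - F (m t)) - (L s - L t)| ≤ Real.exp N * A * |s - t| * e s := by
    intro s hs
    have hi : ∀ r q, 0 ≤ q → Integrable (fun x => δF (m r) x * Real.exp (ℓ q x))
        (π : Measure (E d)) := fun r q hq =>
      ((hF.isBddMeas _).mul (h.isBddMeas hq).exp).integrable _
    have hi' : ∀ r, Integrable (fun x => δF (m r) x * Real.exp (ℓ s x) -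
        δF (m r) x * Real.exp (ℓ t x)) (π : Measure (E d)) := fun r => (hi r s hs).sub (hi r t ht)
    have h1 := hF.convex (m s) (m t)
    have h2 := hF.convex (m t) (m s)
    rw [h.integral_eq hs, h.integral_eq ht] at h1 h2
    simp_rw [mul_comm (Real.exp _)] at h1 h2
    have h3 : (∫ x, δF (m s) x * Real.exp (ℓ s x) ∂(π : Measure (E d))) -
        ∫ x, δF (m s) x * Real.exp (ℓ t x) ∂(π : Measure (E d)) - (L s - L t) ≤
        Real.exp N * A * |s - t| * e s := by
      simp only [hL, he]
      rw [← integral_sub (hi _ _ hs) (hi _ _ ht), ← integral_sub (hi _ _ hs) (hi _ _ ht),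
        ← integral_sub (hi' s) (hi' t), ← integral_const_mul]
      refine integral_mono_ae ((hi' s).sub (hi' t))
        (((hF.isBddMeas _).sub (hF.isBddMeas _)).integrable _ |>.abs.const_mul _) ?_
      filter_upwards [hLip s hs] with x hx
      calc δF (m s) x * Real.exp (ℓ s x) - δF (m s) x * Real.exp (ℓ t x) -
            (δF (m t) x * Real.exp (ℓ s x) - δF (m t) x * Real.exp (ℓ t x))
          = (Real.exp (ℓ s x) - Real.exp (ℓ t x)) * (δF (m s) x - δF (m t) x) := by ring
        _ ≤ |Real.exp (ℓ s x) - Real.exp (ℓ t x)| * |δF (m s) x - δF (m t) x| := by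
          rw [← abs_mul]; exact le_abs_self _
        _ ≤ _ := mul_le_mul_of_nonneg_right hx (abs_nonneg _)
    rw [abs_of_nonneg (by simp only [hL]; linarith)]
    linarith
  rw [hasDerivWithinAt_iff_tendsto_slope] at hlin ⊢
  have hdiff : Tendsto (fun s => slope (fun r => F (m r)) t s - slope L t s)
      (𝓝[Ici 0 \ {t}] t) (𝓝 0) := by
    refine squeeze_zero_norm' (a := fun s => Real.exp N * A * e s) ?_ ?_
    · filter_upwards [self_mem_nhdsWithin] with s hs
      have hst : 0 < |s - t| := abs_pos.2 (sub_ne_zero.2 hs.2)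
      rw [slope_def_field, slope_def_field, ← sub_div, norm_div, Real.norm_eq_abs,
        Real.norm_eq_abs, div_le_iff₀ hst]
      calc _ ≤ _ := hmain s hs.1
        _ = _ := by ring
    · simpa using (he0.mono_left (nhdsWithin_mono _ sdiff_subset)).const_mul (Real.exp N * A)
  simpa using hdiff.add hlin

/-- The energy dissipation identity `d/dt V(m_t) = - ∫ a² dm_t`. -/
lemma hasDerivWithinAt_regularisedEnergy (hF : EnergyAssumption F δF δ2F)
    (h : IsLogDensityFlow δF τ π m ℓ N) {t : ℝ} (ht : 0 ≤ t) :
    HasDerivWithinAt (fun s => F (m s) + τ * ∫ x, ℓ s x ∂(m s : Measure (E d)))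
      (-∫ x, Real.exp (ℓ t x) * logRate δF τ (m t) (ℓ t) x ^ 2 ∂(π : Measure (E d)))
      (Ici 0) t := by
  have hd : ∀ y : ℝ, HasDerivAt (fun y : ℝ => Real.exp y * y) (Real.exp y * y + Real.exp y) y :=
    fun y => ((Real.hasDerivAt_exp y).mul (hasDerivAt_id y)).congr_deriv (by simp)
  have hH := h.hasDerivWithinAt_integral_comp hF (IsBddMeas.const τ) hd (by fun_prop) ht
  have hsum := (h.hasDerivWithinAt_energy hF ht).add hH
  have ha := h.isBddMeas_logRate hF ht
  have hℓ := h.isBddMeas ht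
  refine (hsum.congr_deriv ?_).congr (fun s hs => ?_) ?_
  · set k : ℝ := ∫ y, ℓ t y ∂(m t : Measure (E d)) with hk
    have e0 : ∀ x, δF (m t) x * (Real.exp (ℓ t x) * -logRate δF τ (m t) (ℓ t) x) +
        τ * ((Real.exp (ℓ t x) * ℓ t x + Real.exp (ℓ t x)) * -logRate δF τ (m t) (ℓ t) x) =
        -(Real.exp (ℓ t x) * logRate δF τ (m t) (ℓ t) x ^ 2) -
          (τ + τ * k) * (Real.exp (ℓ t x) * logRate δF τ (m t) (ℓ t) x) := by
      intro x
      have : δF (m t) x = logRate δF τ (m t) (ℓ t) x - τ * ℓ t x + τ * k := by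
        rw [logRate]; ring
      rw [this]
      ring
    rw [← integral_add (((hF.isBddMeas _).mul (hℓ.exp.mul ha.neg)).integrable _)
      (((IsBddMeas.const τ).mul (((hℓ.exp.mul hℓ).add hℓ.exp).mul ha.neg)).integrable _)]
    simp_rw [e0]
    rw [integral_sub ((hℓ.exp.mul (ha.pow 2)).neg.integrable _)
      (((IsBddMeas.const _).mul (hℓ.exp.mul ha)).integrable _), integral_neg, integral_const_mul,
      h.integral_exp_mul_logRate hF ht]
    ring
  · simp only [Pi.add_apply]
    rw [h.integral_eq hs, integral_const_mul]
  · simp only [Pi.add_apply]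
    rw [h.integral_eq ht, integral_const_mul]

end IsLogDensityFlow

/-! ### Decay of the energy -/

/-- The minimiser has a bounded log-density `g` with respect to `π`, for which the first variation
`δF/δm (mstar, ·) + (σ² / 2) g` of the regularised energy is constant. -/
lemma exists_logDensity_minimiser {F : P d → ℝ} {δF : P d → E d → ℝ}
    {δ2F : P d → E d → E d → ℝ} (hF : EnergyAssumption F δF δ2F) {σ : ℝ} (hσ : 0 < σ)
    {π mstar : P d} (hmin : ∀ m', energy F σ π mstar ≤ energy F σ π m') :
    ∃ g : E d → ℝ, IsBddMeas g ∧ (mstar : Measure (E d)) =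
        (π : Measure (E d)).withDensity (fun x => ENNReal.ofReal (Real.exp (g x))) ∧
      ∃ c : ℝ, ∀ x, δF mstar x + σ ^ 2 / 2 * g x = c := by
  have hτ : 0 < σ ^ 2 / 2 := by positivity
  set f : E d → ℝ := fun x => -δF mstar x / (σ ^ 2 / 2) with hf
  have hfb : IsBddMeas f := by
    simpa only [hf, div_eq_mul_inv] using (hF.isBddMeas mstar).neg.mul (IsBddMeas.const _)
  set Z : ℝ := ∫ x, Real.exp (f x) ∂(π : Measure (E d)) with hZ
  have hZ0 : 0 < Z := integral_exp_pos (hfb.exp.integrable _)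
  refine ⟨fun x => f x - Real.log Z, hfb.sub (IsBddMeas.const _), ?_,
    -(σ ^ 2 / 2 * Real.log Z), fun x => ?_⟩
  · rw [minimiser_eq_tilted hF hσ hmin, Measure.tilted]
    simp_rw [Real.exp_sub, Real.exp_log hZ0]
    rfl
  · simp only [hf]
    field_simp
    ring

namespace IsLogDensityFlow

variable {F : P d → ℝ} {δF : P d → E d → ℝ} {δ2F : P d → E d → E d → ℝ} {τ : ℝ} {π : P d}
  {m : ℝ → P d} {ℓ : ℝ → E d → ℝ} {N : ℝ} {mstar : P d} {g : E d → ℝ}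

lemma antitoneOn_regularisedEnergy (hF : EnergyAssumption F δF δ2F)
    (h : IsLogDensityFlow δF τ π m ℓ N) :
    AntitoneOn (fun s => F (m s) + τ * ∫ x, ℓ s x ∂(m s : Measure (E d))) (Ici 0) := by
  refine antitoneOn_of_hasDerivWithinAt_nonpos (convex_Ici 0)
    (fun s hs => (h.hasDerivWithinAt_regularisedEnergy hF hs).continuousWithinAt)
    (fun s hs => (h.hasDerivWithinAt_regularisedEnergy hF (interior_subset hs)).mono
      interior_subset) (fun s hs => ?_)
  exact neg_nonpos.2 (integral_nonneg fun x => by positivity)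

/-- Gibbs' inequality for the measures with log-densities `f₁` and `f₂` relative to `μ`. -/
lemma integral_sub_logDensity_nonneg {μ : Measure (E d)} [IsProbabilityMeasure μ]
    {f₁ f₂ : E d → ℝ} (hf₁ : IsBddMeas f₁) (hf₂ : IsBddMeas f₂)
    (h₁ : ∫ x, Real.exp (f₁ x) ∂μ = 1) (h₂ : ∫ x, Real.exp (f₂ x) ∂μ = 1) :
    0 ≤ ∫ x, Real.exp (f₁ x) * (f₁ x - f₂ x) ∂μ := by
  have hle : ∫ x, (Real.exp (f₁ x) - Real.exp (f₂ x)) ∂μ ≤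
      ∫ x, Real.exp (f₁ x) * (f₁ x - f₂ x) ∂μ := by
    refine integral_mono ((hf₁.exp.sub hf₂.exp).integrable _)
      ((hf₁.exp.mul (hf₁.sub hf₂)).integrable _) fun x => ?_
    have h1 := Real.add_one_le_exp (f₂ x - f₁ x)
    have h2 : Real.exp (f₂ x) = Real.exp (f₁ x) * Real.exp (f₂ x - f₁ x) := by
      rw [← Real.exp_add]; congr 1; ring
    simp only
    rw [h2]
    nlinarith [Real.exp_pos (f₁ x)]
  rwa [integral_sub (hf₁.exp.integrable _) (hf₂.exp.integrable _), h₁, h₂, sub_self] at hle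

/-- The evolution of `KL(mstar | m_t)`. -/
lemma hasDerivWithinAt_relEntropy (hF : EnergyAssumption F δF δ2F)
    (h : IsLogDensityFlow δF τ π m ℓ N) (hg : IsBddMeas g) {t : ℝ} (ht : 0 ≤ t) :
    HasDerivWithinAt (fun s => ∫ x, Real.exp (g x) * (g x - ℓ s x) ∂(π : Measure (E d)))
      (∫ x, Real.exp (g x) * logRate δF τ (m t) (ℓ t) x ∂(π : Measure (E d))) (Ici 0) t := by
  have h1 := (h.hasDerivWithinAt_integral_comp hF hg.exp (fun y => hasDerivAt_id y)
    continuous_const ht).const_sub (∫ x, Real.exp (g x) * g x ∂(π : Measure (E d)))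
  refine (h1.congr_deriv ?_).congr (fun s hs => ?_) ?_
  · rw [← integral_neg]
    refine integral_congr_ae (ae_of_all _ fun x => ?_)
    simp
  all_goals
    simp only [id, mul_sub]
    exact integral_sub ((hg.exp.mul hg).integrable _)
      ((hg.exp.mul (h.isBddMeas (by assumption))).integrable _)

/-- Convexity of `F` bounds the rate integrated against `mstar` by the excess energy and the
relative entropy. -/
lemma integral_exp_mul_logRate_le (hF : EnergyAssumption F δF δ2F)
    (h : IsLogDensityFlow δF τ π m ℓ N) (hg : IsBddMeas g) (hs : (mstar : Measure (E d)) =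
      (π : Measure (E d)).withDensity (fun x => ENNReal.ofReal (Real.exp (g x))))
    {t : ℝ} (ht : 0 ≤ t) :
    ∫ x, Real.exp (g x) * logRate δF τ (m t) (ℓ t) x ∂(π : Measure (E d)) ≤
      -((F (m t) + τ * ∫ x, ℓ t x ∂(m t : Measure (E d))) -
          (F mstar + τ * ∫ x, g x ∂(mstar : Measure (E d)))) -
        τ * ∫ x, Real.exp (g x) * (g x - ℓ t x) ∂(π : Measure (E d)) := by
  have hconv := hF.convex (m t) mstar
  rw [hF.normalised] at hconv
  have hℓ := h.isBddMeas ht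
  rw [← integral_withDensity_exp hg.1 hs, ← integral_withDensity_exp hg.1 hs,
    integral_sub (hg.integrable _) (hℓ.integrable _)]
  unfold logRate
  rw [integral_sub (((hF.isBddMeas _).add ((IsBddMeas.const τ).mul hℓ)).integrable _)
      (integrable_const _),
    integral_add ((hF.isBddMeas _).integrable _) (((IsBddMeas.const τ).mul hℓ).integrable _),
    integral_const_mul]
  simp only [integral_const, probReal_univ, one_smul]
  linarith

/-- As the excess energy is nonincreasing, the inequality `D' ≤ - (V - V_*) - τ D` for
`D = KL(mstar | m_t)` yields this lower bound for the decrease of `D` after integration against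
`exp (τ t)`. -/
lemma exp_sub_one_mul_excess_le (hF : EnergyAssumption F δF δ2F) (hτ : 0 < τ)
    (h : IsLogDensityFlow δF τ π m ℓ N) (hg : IsBddMeas g) (hs : (mstar : Measure (E d)) =
      (π : Measure (E d)).withDensity (fun x => ENNReal.ofReal (Real.exp (g x))))
    {t : ℝ} (ht : 0 ≤ t) :
    ((F (m t) + τ * ∫ x, ℓ t x ∂(m t : Measure (E d))) -
        (F mstar + τ * ∫ x, g x ∂(mstar : Measure (E d)))) * (Real.exp (τ * t) - 1) ≤
      τ * ∫ x, Real.exp (g x) * (ℓ t x - ℓ 0 x) ∂(π : Measure (E d)) := by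
  set D : ℝ → ℝ := fun s => ∫ x, Real.exp (g x) * (g x - ℓ s x) ∂(π : Measure (E d)) with hD
  set V : ℝ → ℝ := fun s => (F (m s) + τ * ∫ x, ℓ s x ∂(m s : Measure (E d))) -
        (F mstar + τ * ∫ x, g x ∂(mstar : Measure (E d))) with hV
  have hmono : ∀ s, 0 ≤ s → s ≤ t → V t ≤ V s := fun s hs0 hst =>
    sub_le_sub_right (h.antitoneOn_regularisedEnergy hF hs0 ht hst) _
  have hexp : ∀ s, HasDerivWithinAt (fun s => Real.exp (τ * s)) (Real.exp (τ * s) * τ)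
      (Ici 0) s := fun s => by
    simpa using ((hasDerivAt_id s).const_mul τ).exp.hasDerivWithinAt
  have hder : ∀ s, 0 ≤ s → HasDerivWithinAt
      (fun s => τ * (Real.exp (τ * s) * D s) + V t * Real.exp (τ * s))
      (τ * (Real.exp (τ * s) * τ * D s + Real.exp (τ * s) *
        ∫ x, Real.exp (g x) * logRate δF τ (m s) (ℓ s) x ∂(π : Measure (E d))) +
        V t * (Real.exp (τ * s) * τ)) (Ici 0) s := fun s hs0 =>
    (((hexp s).mul (h.hasDerivWithinAt_relEntropy hF hg hs0)).const_mul τ).add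
      ((hexp s).const_mul (V t))
  have hanti : AntitoneOn (fun s => τ * (Real.exp (τ * s) * D s) + V t * Real.exp (τ * s))
      (Icc 0 t) := by
    refine antitoneOn_of_hasDerivWithinAt_nonpos (convex_Icc 0 t)
      (fun s hs0 => (hder s hs0.1).continuousWithinAt.mono Icc_subset_Ici_self)
      (fun s hs0 => (hder s (interior_subset hs0).1).mono
        (interior_subset.trans Icc_subset_Ici_self)) (fun s hs0 => ?_)
    have hs1 := interior_subset hs0
    have h1 := h.integral_exp_mul_logRate_le hF hg hs hs1.1
    have h2 := hmono s hs1.1 hs1.2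
    have h3 : τ * D s + (∫ x, Real.exp (g x) * logRate δF τ (m s) (ℓ s) x ∂(π : Measure (E d))) +
        V t ≤ 0 := by
      simp only [hD, hV] at h1 h2 ⊢
      linarith
    have h4 : 0 < τ * Real.exp (τ * s) := by positivity
    nlinarith [mul_nonpos_of_nonneg_of_nonpos h4.le h3]
  have hle := hanti (left_mem_Icc.2 ht) (right_mem_Icc.2 ht) ht
  have hDt : 0 ≤ D t := by
    have hgi : ∫ x, Real.exp (g x) ∂(π : Measure (E d)) = 1 := by
      simpa using (integral_withDensity_exp hg.1 hs fun _ => 1).symm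
    exact integral_sub_logDensity_nonneg hg (h.isBddMeas ht) hgi (h.integral_exp ht)
  have hdiff : ∫ x, Real.exp (g x) * (ℓ t x - ℓ 0 x) ∂(π : Measure (E d)) = D 0 - D t := by
    rw [hD, ← integral_sub ((hg.exp.mul (hg.sub (h.isBddMeas le_rfl))).integrable _)
      ((hg.exp.mul (hg.sub (h.isBddMeas ht))).integrable _)]
    refine integral_congr_ae (ae_of_all _ fun x => ?_)
    simp only
    ring
  rw [hdiff]
  simp only [mul_zero, Real.exp_zero, one_mul, mul_one] at hle
  have h5 : D t ≤ Real.exp (τ * t) * D t :=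
    le_mul_of_one_le_left hDt (Real.one_le_exp (by positivity))
  nlinarith [mul_le_mul_of_nonneg_left h5 hτ.le]

/-- The decrease of `KL(mstar | m_t)` is controlled by the energy dissipated up to time `t`, by
comparing `m_t` and `m_0` through the affinity `∫ √m_t √m_0 (mstar / m_0 - 1)`, whose time
derivative pairs `a √m_t` with `(mstar / m_0 - 1) √m_0`. The bound thus involves the relative
density `mstar / m_0` at the initial time only. -/
lemma integral_logDensity_sub_le (hF : EnergyAssumption F δF δ2F)
    (h : IsLogDensityFlow δF τ π m ℓ N) (hg : IsBddMeas g)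
    (hg1 : ∫ x, Real.exp (g x) ∂(π : Measure (E d)) = 1) {t : ℝ} (ht : 0 ≤ t)
    {lam : ℝ} (hlam : 0 < lam) :
    ∫ x, Real.exp (g x) * (ℓ t x - ℓ 0 x) ∂(π : Measure (E d)) ≤
      lam / 2 * ((F (m 0) + τ * ∫ x, ℓ 0 x ∂(m 0 : Measure (E d))) -
        (F (m t) + τ * ∫ x, ℓ t x ∂(m t : Measure (E d)))) +
      t / (2 * lam) * ∫ x, Real.exp (ℓ 0 x) * (Real.exp (g x - ℓ 0 x) - 1) ^ 2
        ∂(π : Measure (E d)) := by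
  have hℓ0 := h.isBddMeas le_rfl
  have hℓ := h.isBddMeas ht
  have hhalf : Continuous fun y : ℝ => Real.exp (y / 2) := by fun_prop
  set q : E d → ℝ := fun x => Real.exp (g x - ℓ 0 x) - 1 with hq
  have hqb : IsBddMeas q := (hg.sub hℓ0).exp.sub (IsBddMeas.const 1)
  set c : E d → ℝ := fun x => 2 * (Real.exp (ℓ 0 x / 2) * q x) with hc
  have hcb : IsBddMeas c := (IsBddMeas.const 2).mul ((hℓ0.comp_continuous hhalf).mul hqb)
  set χ : ℝ := ∫ x, Real.exp (ℓ 0 x) * q x ^ 2 ∂(π : Measure (E d)) with hχ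
  set Ψ : ℝ → ℝ := fun s => ∫ x, c x * Real.exp (ℓ s x / 2) ∂(π : Measure (E d)) with hΨ
  set V : ℝ → ℝ := fun s => F (m s) + τ * ∫ x, ℓ s x ∂(m s : Measure (E d)) with hV
  have hsq : ∀ y : ℝ, Real.exp y = Real.exp (y / 2) * Real.exp (y / 2) := fun y => by
    rw [← Real.exp_add, add_halves]
  have hφ : ∀ y : ℝ, HasDerivAt (fun y : ℝ => Real.exp (y / 2)) (Real.exp (y / 2) * (1 / 2)) y :=
    fun y => ((hasDerivAt_id y).div_const 2).exp
  have hder : ∀ s, 0 ≤ s → HasDerivWithinAt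
      (fun s => Ψ s + lam / 2 * V s - s * (1 / (2 * lam) * χ)) _ (Ici 0) s := fun s hs0 =>
    ((h.hasDerivWithinAt_integral_comp hF hcb hφ (by fun_prop) hs0).add
      ((h.hasDerivWithinAt_regularisedEnergy hF hs0).const_mul (lam / 2))).sub
      ((hasDerivAt_id s).mul_const (1 / (2 * lam) * χ)).hasDerivWithinAt
  -- the time derivative of the affinity is at most `(λ / 2) ∫ a² dm_s + χ / (2 λ)`
  have hanti : AntitoneOn (fun s => Ψ s + lam / 2 * V s - s * (1 / (2 * lam) * χ)) (Ici 0) := by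
    refine antitoneOn_of_hasDerivWithinAt_nonpos (convex_Ici 0)
      (fun s hs0 => (hder s hs0).continuousWithinAt)
      (fun s hs0 => (hder s (interior_subset hs0)).mono interior_subset) (fun s hs0 => ?_)
    have hs1 : 0 ≤ s := interior_subset hs0
    have ha := h.isBddMeas_logRate hF hs1
    have hℓs := h.isBddMeas hs1
    have hle : ∫ x, c x * (Real.exp (ℓ s x / 2) * (1 / 2) * -logRate δF τ (m s) (ℓ s) x)
          ∂(π : Measure (E d)) ≤
        ∫ x, (lam / 2 * (Real.exp (ℓ s x) * logRate δF τ (m s) (ℓ s) x ^ 2) +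
          1 / (2 * lam) * (Real.exp (ℓ 0 x) * q x ^ 2)) ∂(π : Measure (E d)) := by
      refine integral_mono
        ((hcb.mul (((hℓs.comp_continuous hhalf).mul (IsBddMeas.const _)).mul ha.neg)).integrable _)
        ((((IsBddMeas.const _).mul (hℓs.exp.mul (ha.pow 2))).add
          ((IsBddMeas.const _).mul (hℓ0.exp.mul (hqb.pow 2)))).integrable _) fun x => ?_
      simp only [hc]
      rw [hsq (ℓ s x), hsq (ℓ 0 x)]
      set X := Real.exp (ℓ s x / 2) * logRate δF τ (m s) (ℓ s) x with hX
      set Y := Real.exp (ℓ 0 x / 2) * q x with hY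
      have e1 : 2 * Y * (Real.exp (ℓ s x / 2) * (1 / 2) * -logRate δF τ (m s) (ℓ s) x) =
          -(X * Y) := by rw [hX]; ring
      have e2 : lam / 2 * (Real.exp (ℓ s x / 2) * Real.exp (ℓ s x / 2) *
          logRate δF τ (m s) (ℓ s) x ^ 2) + 1 / (2 * lam) *
          (Real.exp (ℓ 0 x / 2) * Real.exp (ℓ 0 x / 2) * q x ^ 2) =
          lam / 2 * X ^ 2 + 1 / (2 * lam) * Y ^ 2 := by rw [hX, hY]; ring
      rw [e1, e2, ← sub_nonneg]
      have e3 : lam / 2 * X ^ 2 + 1 / (2 * lam) * Y ^ 2 - -(X * Y) =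
          (lam * X + Y) ^ 2 / (2 * lam) := by field_simp; ring
      rw [e3]
      positivity
    rw [integral_add (((IsBddMeas.const _).mul (hℓs.exp.mul (ha.pow 2))).integrable _)
      (((IsBddMeas.const _).mul (hℓ0.exp.mul (hqb.pow 2))).integrable _), integral_const_mul,
      integral_const_mul] at hle
    linarith
  have hle := hanti self_mem_Ici ht ht
  have hmid : ∀ x, c x * Real.exp (ℓ 0 x / 2) = 2 * (Real.exp (g x) - Real.exp (ℓ 0 x)) := by
    intro x
    have : Real.exp (g x) = Real.exp (ℓ 0 x) * Real.exp (g x - ℓ 0 x) := by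
      rw [← Real.exp_add]; congr 1; ring
    simp only [hc, hq]
    rw [this, hsq (ℓ 0 x)]
    ring
  have hΨ0 : Ψ 0 = 0 := by
    simp only [hΨ, hmid]
    rw [integral_const_mul, integral_sub (hg.exp.integrable _) (hℓ0.exp.integrable _), hg1,
      h.integral_exp le_rfl]
    simp
  have hΨt : ∫ x, Real.exp (g x) * (ℓ t x - ℓ 0 x) ∂(π : Measure (E d)) ≤ Ψ t := by
    have hle' : ∫ x, Real.exp (g x) * (ℓ t x - ℓ 0 x) ∂(π : Measure (E d)) ≤
        ∫ x, (c x * Real.exp (ℓ t x / 2) +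
          (Real.exp (ℓ t x) + Real.exp (ℓ 0 x) - 2 * Real.exp (g x))) ∂(π : Measure (E d)) := by
      refine integral_mono ((hg.exp.mul (hℓ.sub hℓ0)).integrable _)
        (((hcb.mul (hℓ.comp_continuous hhalf)).add
          ((hℓ.exp.add hℓ0.exp).sub ((IsBddMeas.const 2).mul hg.exp))).integrable _) fun x => ?_
      -- `log u ≤ 2 (√u - 1)` for `u = m_t / m_0`, and `2 √m_t √m_0 ≤ m_t + m_0`
      have h1 := Real.add_one_le_exp ((ℓ t x - ℓ 0 x) / 2)
      have e1 : c x * Real.exp (ℓ t x / 2) = 2 * (Real.exp (g x) *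
          Real.exp ((ℓ t x - ℓ 0 x) / 2)) - 2 * (Real.exp (ℓ t x / 2) * Real.exp (ℓ 0 x / 2)) := by
        simp only [hc, hq]
        have : Real.exp (g x) * Real.exp ((ℓ t x - ℓ 0 x) / 2) =
            Real.exp (ℓ 0 x / 2) * Real.exp (g x - ℓ 0 x) * Real.exp (ℓ t x / 2) := by
          rw [← Real.exp_add, ← Real.exp_add, ← Real.exp_add]; congr 1; ring
        rw [this]
        ring
      simp only
      rw [e1, hsq (ℓ t x), hsq (ℓ 0 x)]
      nlinarith [mul_le_mul_of_nonneg_left h1 (Real.exp_pos (g x)).le,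
        sq_nonneg (Real.exp (ℓ t x / 2) - Real.exp (ℓ 0 x / 2))]
    rw [integral_add ((hcb.mul (hℓ.comp_continuous hhalf)).integrable _)
        (((hℓ.exp.add hℓ0.exp).sub ((IsBddMeas.const 2).mul hg.exp)).integrable _),
      integral_sub ((hℓ.exp.add hℓ0.exp).integrable _)
        (((IsBddMeas.const 2).mul hg.exp).integrable _),
      integral_add (hℓ.exp.integrable _) (hℓ0.exp.integrable _), integral_const_mul, hg1,
      h.integral_exp le_rfl, h.integral_exp ht] at hle'
    linarith
  simp only [hΨ0] at hle
  have e : t / (2 * lam) * χ = t * (1 / (2 * lam) * χ) := by ring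
  rw [e]
  linarith

/-- By convexity of `F` and the first-order condition, the excess energy of `m_0` is at least
`τ KL(m_0 | mstar)`. -/
lemma relEntropy_le_excess (hF : EnergyAssumption F δF δ2F)
    (h : IsLogDensityFlow δF τ π m ℓ N) (hg : IsBddMeas g) {c : ℝ}
    (hc : ∀ x, δF mstar x + τ * g x = c) :
    τ * ∫ x, Real.exp (ℓ 0 x) * (ℓ 0 x - g x) ∂(π : Measure (E d)) ≤
      (F (m 0) + τ * ∫ x, ℓ 0 x ∂(m 0 : Measure (E d))) -
        (F mstar + τ * ∫ x, g x ∂(mstar : Measure (E d))) := by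
  have hconv := hF.convex mstar (m 0)
  have hint : ∀ μ : P d, ∫ x, δF mstar x ∂(μ : Measure (E d)) =
      c - τ * ∫ x, g x ∂(μ : Measure (E d)) := by
    intro μ
    simp_rw [fun x => eq_sub_of_add_eq (hc x)]
    rw [integral_sub (integrable_const _) (((IsBddMeas.const τ).mul hg).integrable _),
      integral_const_mul]
    simp
  rw [hint, hint] at hconv
  rw [← h.integral_eq le_rfl, integral_sub ((h.isBddMeas le_rfl).integrable _) (hg.integrable _)]
  linarith

end IsLogDensityFlow

/-- The `χ²`-divergence of two measures whose relative density is pinched between `r` and `R` is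
controlled by the relative entropy with the arguments interchanged. -/
lemma chiSq_le_relEntropy {μ : Measure (E d)} [IsProbabilityMeasure μ] {f g : E d → ℝ}
    (hf : IsBddMeas f) (hg : IsBddMeas g) (hf1 : ∫ x, Real.exp (f x) ∂μ = 1)
    (hg1 : ∫ x, Real.exp (g x) ∂μ = 1) {r R : ℝ} (hr : 0 < r) (hR : 1 < R)
    (hrR : ∀ᵐ x ∂μ, r ≤ Real.exp (f x - g x) ∧ Real.exp (f x - g x) ≤ R) :
    ∫ x, Real.exp (f x) * (Real.exp (g x - f x) - 1) ^ 2 ∂μ ≤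
      2 * R / r * ∫ x, Real.exp (f x) * (f x - g x) ∂μ := by
  have hle : ∫ x, Real.exp (f x) * (Real.exp (g x - f x) - 1) ^ 2 ∂μ ≤
      ∫ x, 2 * R / r * (Real.exp (f x) * (f x - g x) + (Real.exp (g x) - Real.exp (f x))) ∂μ := by
    refine integral_mono_ae
      ((hf.exp.mul (((hg.sub hf).exp.sub (IsBddMeas.const 1)).pow 2)).integrable _)
      (((IsBddMeas.const _).mul ((hf.exp.mul (hf.sub hg)).add (hg.exp.sub hf.exp))).integrable
      _) ?_
    filter_upwards [hrR] with x hx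
    set u := Real.exp (f x - g x) with hu
    have hu0 : 0 < u := Real.exp_pos _
    have e1 : Real.exp (f x) = Real.exp (g x) * u := by
      rw [hu, ← Real.exp_add]; congr 1; ring
    have e2 : Real.exp (g x - f x) = u⁻¹ := by
      rw [hu, ← Real.exp_neg]; congr 1; ring
    have e3 : f x - g x = Real.log u := by rw [hu, Real.log_exp]
    rw [e2, e3, e1]
    have hk := sq_sub_one_le_mul_klFun hu0 hR.le hx.2
    have hk0 : 0 ≤ 2 * R * klFun u := (sq_nonneg _).trans hk
    calc Real.exp (g x) * u * (u⁻¹ - 1) ^ 2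
        = Real.exp (g x) * ((u - 1) ^ 2 / u) := by field_simp; ring
      _ ≤ Real.exp (g x) * (2 * R * klFun u / r) := by
          refine mul_le_mul_of_nonneg_left ?_ (Real.exp_pos _).le
          exact div_le_div₀ hk0 hk hr hx.1
      _ = _ := by rw [klFun_apply]; ring
  rwa [integral_const_mul, integral_add ((hf.exp.mul (hf.sub hg)).integrable _)
    ((hg.exp.sub hf.exp).integrable _), integral_sub (hg.exp.integrable _) (hf.exp.integrable _),
    hf1, hg1, sub_self, add_zero] at hle

section Decay

variable {F : P d → ℝ} {δF : P d → E d → ℝ} {δ2F : P d → E d → E d → ℝ} {σ : ℝ} {U : E d → ℝ}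
  {π mstar : P d} {m : ℝ → P d}

lemma exists_ratioBounds_minimiser (hF : EnergyAssumption F δF δ2F) (hσ : 0 < σ)
    (hπ : IsGibbs U π) (hm₀ : InitialAssumption (m 0) π)
    (hmstar : ∀ m', energy F σ π mstar ≤ energy F σ π m') :
    ∃ r R : ℝ, 0 < r ∧ 1 < R ∧ RatioBounds (m 0) mstar r R := by
  obtain ⟨g, hg, hs, -⟩ := exists_logDensity_minimiser hF hσ hmstar
  have hgstar := hπ.ae_dens_eq_mul_exp hg.1 hs
  obtain ⟨-, r, R, hr, hR, hrR⟩ := hm₀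
  obtain ⟨B, hB⟩ := hg.2
  have hB0 : 0 ≤ B := (abs_nonneg _).trans (hB 0)
  refine ⟨r * Real.exp (-B), R * Real.exp B, by positivity,
    one_lt_mul_of_lt_of_le hR (Real.one_le_exp hB0), ?_⟩
  filter_upwards [hrR, hgstar] with x hx hgx
  rw [hgx, ← div_div, div_eq_mul_inv _ (Real.exp (g x)), ← Real.exp_neg]
  have hb := abs_le.1 (hB x)
  have h0 : 0 ≤ dens (m 0) x / dens π x := hr.le.trans hx.1
  exact ⟨mul_le_mul hx.1 (Real.exp_le_exp.2 (by linarith)) (Real.exp_pos _).le h0,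
    mul_le_mul hx.2 (Real.exp_le_exp.2 (by linarith)) (Real.exp_pos _).le (by linarith)⟩

lemma energy_sub_le_mul_exp (hF : EnergyAssumption F δF δ2F) (hσ : 0 < σ)
    (hπ : IsGibbs U π) (hm₀ : InitialAssumption (m 0) π) (hm : IsBirthDeathFlow δF σ π m)
    (hmstar : ∀ m', energy F σ π mstar ≤ energy F σ π m') {r R : ℝ} (hr : 0 < r) (hR : 1 < R)
    (hrR : RatioBounds (m 0) mstar r R) {t : ℝ} (ht : 0 ≤ t) :
    energy F σ π (m t) - energy F σ π mstar ≤ (energy F σ π (m 0) - energy F σ π mstar) *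
      ((Real.exp (-(σ ^ 2 * r / (4 * R)) * t) : ℝ) : EReal) := by
  obtain ⟨C, -, hC⟩ := hF.bound_first
  obtain ⟨ℓ, N, h⟩ := exists_isLogDensityFlow hσ hC hπ hm₀ hm
  obtain ⟨g, hg, hs, c, hc⟩ := exists_logDensity_minimiser hF hσ hmstar
  have hgstar := hπ.ae_dens_eq_mul_exp hg.1 hs
  set τ : ℝ := σ ^ 2 / 2 with hτdef
  have hτ : 0 < τ := by positivity
  have hℓ0 := h.isBddMeas le_rfl
  have hratio : ∀ᵐ x ∂(π : Measure (E d)),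
      r ≤ Real.exp (ℓ 0 x - g x) ∧ Real.exp (ℓ 0 x - g x) ≤ R := by
    refine hπ.ac_volume.ae_le ?_
    filter_upwards [hrR, hgstar, hπ.ae_dens_eq_mul_exp hℓ0.1 (h.density 0 le_rfl),
      hπ.ae_dens_pos] with x hx hgx hℓx hρ
    rwa [hgx, hℓx, mul_div_mul_left _ _ hρ.ne', ← Real.exp_sub] at hx
  have hg1 : ∫ x, Real.exp (g x) ∂(π : Measure (E d)) = 1 := by
    simpa using (integral_withDensity_exp hg.1 hs fun _ => 1).symm
  -- both measures have mass one
  have hr1 : r ≤ 1 := by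
    have : ∫ x, r * Real.exp (g x) ∂(π : Measure (E d)) ≤
        ∫ x, Real.exp (ℓ 0 x) ∂(π : Measure (E d)) := by
      refine integral_mono_ae (((IsBddMeas.const r).mul hg.exp).integrable _)
        (hℓ0.exp.integrable _) ?_
      filter_upwards [hratio] with x hx
      have := mul_le_mul_of_nonneg_right hx.1 (Real.exp_pos (g x)).le
      rwa [← Real.exp_add, sub_add_cancel] at this
    rwa [integral_const_mul, hg1, h.integral_exp le_rfl, mul_one] at this
  have hV : ∀ s, 0 ≤ s → energy F σ π (m s) =
      ((F (m s) + τ * ∫ x, ℓ s x ∂(m s : Measure (E d)) : ℝ) : EReal) := fun s hs0 => by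
    rw [energy_eq_coe F σ (klDiv_withDensity_exp_ne_top (h.measurable s hs0) (h.bound s)
      (h.density s hs0)), KL,
      toReal_klDiv_withDensity_exp (h.measurable s hs0) (h.density s hs0)]
  have hVs : energy F σ π mstar =
      ((F mstar + τ * ∫ x, g x ∂(mstar : Measure (E d)) : ℝ) : EReal) := by
    obtain ⟨B, hB⟩ := hg.2
    rw [energy_eq_coe F σ (klDiv_withDensity_exp_ne_top hg.1 hB hs), KL,
      toReal_klDiv_withDensity_exp hg.1 hs]
  have hmin := hmstar (m 0)
  have hdecay := h.exp_sub_one_mul_excess_le hF hτ hg hs ht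
  have hexcess := h.relEntropy_le_excess hF hg hc
  have hchi := chiSq_le_relEntropy hℓ0 hg (h.integral_exp le_rfl) hg1 hr hR hratio
  set β : ℝ := r / (2 * R) with hβdef
  have hR0 : 0 < R := by linarith
  have hβ : 0 < β := by positivity
  have hβ' : 2 * β ≤ 1 := by
    rw [hβdef, ← mul_div_assoc, mul_div_mul_left _ _ two_ne_zero, div_le_one hR0]
    linarith
  -- this choice of `λ` turns the dissipation estimate into the hypothesis of
  -- `le_mul_exp_neg_of_integrated`
  have hdiss := h.integral_logDensity_sub_le hF hg hg1 ht
    (lam := Real.exp (β * (τ * t)) / (β * τ)) (by positivity)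
  rw [hV 0 le_rfl, hVs, EReal.coe_le_coe_iff] at hmin
  rw [hV t ht, hV 0 le_rfl, hVs, ← EReal.coe_sub, ← EReal.coe_sub, ← EReal.coe_mul,
    EReal.coe_le_coe_iff]
  set Vt := F (m t) + τ * ∫ x, ℓ t x ∂(m t : Measure (E d))
  set V0 := F (m 0) + τ * ∫ x, ℓ 0 x ∂(m 0 : Measure (E d))
  set Vs := F mstar + τ * ∫ x, g x ∂(mstar : Measure (E d))
  set χ := ∫ x, Real.exp (ℓ 0 x) * (Real.exp (g x - ℓ 0 x) - 1) ^ 2 ∂(π : Measure (E d))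
  set D := ∫ x, Real.exp (ℓ 0 x) * (ℓ 0 x - g x) ∂(π : Measure (E d))
  have hχ : β * τ * χ ≤ V0 - Vs := by
    have h1 : β * χ ≤ D := by
      have := mul_le_mul_of_nonneg_left hchi hβ.le
      have e : β * (2 * R / r * D) = D := by rw [hβdef]; field_simp
      rwa [e] at this
    nlinarith [mul_le_mul_of_nonneg_left h1 hτ.le]
  have hexp : -(σ ^ 2 * r / (4 * R)) * t = -(β * (τ * t)) := by
    rw [hβdef, hτdef]; field_simp; ring
  rw [hexp]
  refine le_mul_exp_neg_of_integrated hβ hβ' (by positivity) (sub_nonneg.2 hmin)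
    (hdecay.trans ((mul_le_mul_of_nonneg_left hdiss hτ.le).trans ?_))
  have e1 : τ * (Real.exp (β * (τ * t)) / (β * τ) / 2 * (V0 - Vt) +
      t / (2 * (Real.exp (β * (τ * t)) / (β * τ))) * χ) =
      Real.exp (β * (τ * t)) / (2 * β) * (V0 - Vs - (Vt - Vs)) +
        τ * t * (β * τ * χ) * Real.exp (-(β * (τ * t))) / 2 := by
    rw [Real.exp_neg]
    field_simp
    ring
  rw [e1]
  gcongr

end Decay

end FisherRao

theorem mainTheorem2 (d : ℕ) (σ : ℝ) (hσ : 0 < σ)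
    (F : FisherRao.P d → ℝ)
    (δF : FisherRao.P d → FisherRao.E d → ℝ)
    (δ2F : FisherRao.P d → FisherRao.E d → FisherRao.E d → ℝ)
    (hF : FisherRao.EnergyAssumption F δF δ2F)
    (U : FisherRao.E d → ℝ) (π : FisherRao.P d) (hπ : FisherRao.IsGibbs U π)
    (m : ℝ → FisherRao.P d)
    (hm₀ : FisherRao.InitialAssumption (m 0) π)
    (hm : FisherRao.IsBirthDeathFlow δF σ π m)
    (mstar : FisherRao.P d)
    (hmstar : ∀ m' : FisherRao.P d,
      FisherRao.energy F σ π mstar ≤ FisherRao.energy F σ π m') :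
    (∃ rbar Rbar : ℝ, 0 < rbar ∧ 1 < Rbar ∧ FisherRao.RatioBounds (m 0) mstar rbar Rbar) ∧
    ∀ rbar Rbar : ℝ, 0 < rbar → 1 < Rbar → FisherRao.RatioBounds (m 0) mstar rbar Rbar →
      ∀ t : ℝ, 0 ≤ t →
        FisherRao.energy F σ π (m t) - FisherRao.energy F σ π mstar ≤
          (FisherRao.energy F σ π (m 0) - FisherRao.energy F σ π mstar) *
            ((Real.exp (-(σ ^ 2 * rbar / (4 * Rbar)) * t) : ℝ) : EReal) := by
  exact ⟨FisherRao.exists_ratioBounds_minimiser hF hσ hπ hm₀ hmstar, fun _ _ hr hR hrR _ ht =>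
    FisherRao.energy_sub_le_mul_exp hF hσ hπ hm₀ hm hmstar hr hR hrR ht⟩
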